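/- Let $R$ be a commutative ring (for instance a field, or $\mathbb{Z}$), let $G$ be a finite solvable group, and let $V$ be a finite $R$-module on which $G$ acts faithfully by $R$-linear automorphisms. Suppose that $V$ is a quasiprimitive $G$-module, that is, $V$ is completely reducible as an $R[G]$-module and for every normal subgroup $N$ of $G$ (including $N=1$ and $N=G$) the restriction $V_N$ is homogeneous, i.e. a direct sum of pairwise isomorphic simple $R[N]$-modules. If $|V||G|$ is odd, then there exists $v \in V$ such that the centralizer $\mathbf{C}_G(v)=\{g\in G : gv=v\}$ is cyclic. -/

import Mathlib

namespace Representation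

/-- The module afforded by `ρ` is homogeneous: it is a direct sum of simple `R[G]`-modules that
are pairwise isomorphic (semisimple, and any two simple submodules are isomorphic). -/
def IsHomogeneous {R G V : Type*} [CommRing R] [Group G] [AddCommGroup V] [Module R V]
    (ρ : Representation R G V) : Prop :=
  IsSemisimpleModule (MonoidAlgebra R G) ρ.asModule ∧ IsIsotypic (MonoidAlgebra R G) ρ.asModule

/-- The restriction of `ρ` to a subgroup `N` of `G` (the module `V_N`). -/
def restrictSubgroup {R G V : Type*} [CommRing R] [Group G] [AddCommGroup V] [Module R V]
    (ρ : Representation R G V) (N : Subgroup G) : Representation R N V :=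
  ρ.comp N.subtype

/-- The `G`-module `V` is quasiprimitive: it is completely reducible, and its restriction to
every normal subgroup of `G` is homogeneous. -/
def IsQuasiprimitive {R G V : Type*} [CommRing R] [Group G] [AddCommGroup V] [Module R V]
    (ρ : Representation R G V) : Prop :=
  IsSemisimpleModule (MonoidAlgebra R G) ρ.asModule ∧
    ∀ N : Subgroup G, N.Normal → (ρ.restrictSubgroup N).IsHomogeneous

/-- The centralizer `C_G(v) = {g ∈ G | g v = v}` of a vector `v`. -/
def vectorCentralizer {R G V : Type*} [CommRing R] [Group G] [AddCommGroup V] [Module R V]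
    (ρ : Representation R G V) (v : V) : Subgroup G where
  carrier := {g | ρ g v = v}
  one_mem' := by simp
  mul_mem' := by
    intro a b ha hb
    simp only [Set.mem_ofPred_eq] at ha hb ⊢
    rw [map_mul, Module.End.mul_apply, hb, ha]
  inv_mem' := by
    intro a ha
    simp only [Set.mem_ofPred_eq] at ha ⊢
    conv_lhs => rw [← ha]
    rw [← Module.End.mul_apply, ← map_mul, inv_mul_cancel, map_one, Module.End.one_apply]

end Representation

/-!
Let `T` be maximal among the commutative normal subgroups of `G`. As the restriction of `V` to `T`
is homogeneous, Schur's lemma shows that the image `K` of `R[T]` in `End V` is a finite field; `T`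
acts on the `K`-space `V` by scalars, `C_G(T)` acts `K`-linearly, and `G` permutes the elements of
`K` by conjugation. An element that induces the trivial automorphism of `K` centralizes `T`. Hence,
if `v` has trivial stabilizer in `C_G(T)`, then `C_G(v)` embeds in the cyclic group `Aut K`
(`exists_isCyclic_vectorCentralizer_of_field`), and the task is to find such a regular vector
(`IsScalarAction.exists_regular_vector`). It is found by counting.

Choose `F` normal in `G` with `T ≤ F ≤ C_G(T)`, with `F / T` abelian of squarefree exponent, and
large enough that `C_G(F) ≤ T` (`IsMaximalCommutativeNormal.exists_layer`). Commutators give an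
alternating pairing on `U = F / T` with values in `Kˣ`, and by the maximality of `T` it is
nondegenerate on every `G`-invariant subgroup (`IsSelfCentralizingLayer.exists_action`). So
`|U| = e ^ 2` for some `e`. Representatives of `U` act as linearly independent operators, so `e` is
at most `d = dim V` (`IsScalarAction.relIndex_le_finrank_sq`), and every prime divisor of `e`
divides `|T|`, which divides `|K| - 1`.

On the one hand, an element of `C_G(T)` outside `T` has small eigenspaces, because its commutators
with `F` shift its eigenvalues (`IsScalarAction.two_mul_finrank_eigenspace_le`): of dimension at
most `2 d / 3`, or `3 d / 5` if `3` does not divide `e`. On the other hand, `|C_G(T) : T|` is at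
most `|U| |B|`, where `B` is the group of automorphisms of `U` induced by `C_G(T)`. Because `B` preserves
the pairing, the orbits in a chain of pointwise stabilizers are short, which bounds `|B|` in terms
of `e` (`IsAnisotropicAction.card_le_prod`). For all but a few `e` this makes the vectors with
nontrivial stabilizer too few to fill `V`. The case `e = 3` does not occur, and the cases
`e = 5, 7, 9, 27` need sharper bounds. There `|U|` is a power of a prime `p`. The group `B` has no
nontrivial `p`-subgroup that is normal in the group `Γ` induced by `G`, and fixed-point counts leave
few other prime divisors of `|B|`, each of which divides it at most once. So a maximal commutative
subgroup of `B` that is normal in `Γ` is cyclic and self-centralizing in `B`, which makes `|B|` very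
small (`IsSelfCentralizingLayer.exists_relIndex_le`).
-/

open Subgroup
open scoped commutatorElement

/-! ### Solvable groups, power torsion and commutator pairings -/

/-- The last nontrivial term of the derived series of `N` is normal in `G` and commutative. -/
theorem exists_normal_abelian_le {G : Type*} [Group G] [Finite G] (hG : Group.IsSolvable G)
    (N : Subgroup G) [hN : N.Normal] (hne : N ≠ ⊥) :
    ∃ M : Subgroup G, M.Normal ∧ M ≠ ⊥ ∧ M ≤ N ∧ ∀ x ∈ M, ∀ y ∈ M, x * y = y * x := by
  classical
  let f : ℕ → Subgroup G := fun k => (fun L : Subgroup G => ⁅L, L⁆)^[k] N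
  have hf : ∀ k, f (k + 1) = ⁅f k, f k⁆ := fun k => Function.iterate_succ_apply' _ _ _
  have hnorm : ∀ k, (f k).Normal := by
    intro k
    induction k with
    | zero => exact hN
    | succ k ih => rw [hf]; infer_instance
  have hleN : ∀ k, f k ≤ N := by
    intro k
    induction k with
    | zero => exact le_rfl
    | succ k ih =>
      have := hnorm k
      rw [hf]; exact (commutator_le_left _ _).trans ih
  have hled : ∀ k, f k ≤ derivedSeries G k := by
    intro k
    induction k with
    | zero => exact le_top
    | succ k ih => rw [hf]; exact commutator_mono ih ih
  obtain ⟨n, hn⟩ := hG.solvable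
  have hex : ∃ k, f k = ⊥ := ⟨n, le_bot_iff.1 ((hled n).trans hn.le)⟩
  have hk0 : Nat.find hex ≠ 0 := fun h => hne (by have := Nat.find_spec hex; rwa [h] at this)
  obtain ⟨k, hk⟩ := Nat.exists_eq_succ_of_ne_zero hk0
  refine ⟨f k, hnorm k, Nat.find_min hex (by omega), hleN k, fun x hx y hy => ?_⟩
  have h1 : ⁅f k, f k⁆ = ⊥ := by rw [← hf, ← Nat.succ_eq_add_one, ← hk]; exact Nat.find_spec hex
  have := commutator_mem_commutator hx hy
  rw [h1, mem_bot] at this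
  exact commutatorElement_eq_one_iff_mul_comm.1 this

/-- The elements of exponent dividing `n` in a commutative subgroup. -/
def Subgroup.powTorsion {G : Type*} [Group G] (M : Subgroup G)
    (hM : ∀ x ∈ M, ∀ y ∈ M, x * y = y * x) (n : ℕ) : Subgroup G where
  carrier := {x | x ∈ M ∧ x ^ n = 1}
  one_mem' := ⟨M.one_mem, one_pow n⟩
  mul_mem' := by
    rintro a b ⟨ha, ha'⟩ ⟨hb, hb'⟩
    exact ⟨M.mul_mem ha hb, by rw [Commute.mul_pow (hM a ha b hb), ha', hb', one_mul]⟩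
  inv_mem' := by
    rintro a ⟨ha, ha'⟩
    exact ⟨M.inv_mem ha, by rw [inv_pow, ha', inv_one]⟩

theorem Subgroup.powTorsion_normal {G : Type*} [Group G] (M : Subgroup G) [hMn : M.Normal]
    (hM : ∀ x ∈ M, ∀ y ∈ M, x * y = y * x) (n : ℕ) : (M.powTorsion hM n).Normal where
  conj_mem := by
    rintro a ⟨ha, ha'⟩ g
    exact ⟨hMn.conj_mem a ha g, by rw [conj_pow, ha', mul_one, mul_inv_cancel]⟩

theorem exists_normal_elementary_abelian_le {G : Type*} [Group G] [Finite G]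
    (hG : Group.IsSolvable G) (N : Subgroup G) [N.Normal] (hne : N ≠ ⊥) :
    ∃ (p : ℕ) (M : Subgroup G), p.Prime ∧ M.Normal ∧ M ≠ ⊥ ∧ M ≤ N ∧
      (∀ x ∈ M, ∀ y ∈ M, x * y = y * x) ∧ ∀ x ∈ M, x ^ p = 1 := by
  obtain ⟨M, hMn, hM1, hMN, hMc⟩ := exists_normal_abelian_le hG N hne
  have hcard : Nat.card M ≠ 1 := fun h => hM1 (card_eq_one.1 h)
  obtain ⟨p, hp, hpd⟩ := Nat.exists_prime_and_dvd hcard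
  have := Fact.mk hp
  obtain ⟨x, hx⟩ := exists_prime_orderOf_dvd_card' p hpd
  refine ⟨p, M.powTorsion hMc p, hp, M.powTorsion_normal hMc p, fun h => ?_,
    fun y hy => hMN hy.1, fun a ha b hb => hMc a ha.1 b hb.1, fun a ha => ha.2⟩
  have hxm : (x : G) ∈ M.powTorsion hMc p :=
    ⟨x.2, by rw [← hx, ← orderOf_coe, pow_orderOf_eq_one]⟩
  rw [h, mem_bot] at hxm
  have : orderOf (x : G) = p := by rw [orderOf_coe, hx]
  rw [hxm, orderOf_one] at this
  exact hp.one_lt.ne this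

/-- Between two normal subgroups `T < C` of a solvable group there is a normal subgroup `M` of
`G` whose section `M / T` is a nontrivial elementary abelian `p`-group. -/
theorem exists_normal_elementary_abelian_between {G : Type*} [Group G] [Finite G]
    (hG : Group.IsSolvable G) (T C : Subgroup G) [hTn : T.Normal] [hCn : C.Normal] (h : T < C) :
    ∃ (p : ℕ) (M : Subgroup G), p.Prime ∧ M.Normal ∧ T < M ∧ M ≤ C ∧
      (∀ x ∈ M, ∀ y ∈ M, ⁅x, y⁆ ∈ T) ∧ ∀ x ∈ M, x ^ p ∈ T := by
  have := hG
  have hN : (C.map (QuotientGroup.mk' T)).Normal :=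
    hCn.map _ (QuotientGroup.mk'_surjective T)
  have hne : C.map (QuotientGroup.mk' T) ≠ ⊥ := by
    rw [Ne, Subgroup.map_eq_bot_iff, QuotientGroup.ker_mk']
    exact fun h' => h.not_ge h'
  have hsq : Group.IsSolvable (G ⧸ T) := inferInstance
  obtain ⟨p, M, hp, hMn, hM1, hMC, hMc, hMp⟩ :=
    exists_normal_elementary_abelian_le hsq (C.map (QuotientGroup.mk' T)) hne
  have hker : T ≤ M.comap (QuotientGroup.mk' T) := by
    intro t ht
    rw [mem_comap, QuotientGroup.mk'_apply, (QuotientGroup.eq_one_iff t).2 ht]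
    exact M.one_mem
  refine ⟨p, M.comap (QuotientGroup.mk' T), hp, hMn.comap _, lt_of_le_of_ne hker ?_, ?_, ?_, ?_⟩
  · intro heq
    apply hM1
    rw [← map_comap_eq_self_of_surjective (QuotientGroup.mk'_surjective T) M, ← heq,
      Subgroup.map_eq_bot_iff, QuotientGroup.ker_mk']
  · have := comap_mono (f := QuotientGroup.mk' T) hMC
    rwa [comap_map_eq_self (by rw [QuotientGroup.ker_mk']; exact h.le)] at this
  · intro x hx y hy
    rw [← QuotientGroup.eq_one_iff, ← QuotientGroup.mk'_apply, map_commutatorElement,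
      commutatorElement_eq_one_iff_mul_comm]
    exact hMc _ hx _ hy
  · intro x hx
    rw [← QuotientGroup.eq_one_iff, ← QuotientGroup.mk'_apply, map_pow]
    exact hMp _ hx

/-- Linear independence of characters bounds the number of characters of a finite group. -/
theorem card_monoidHom_units_le (Z : Type*) [Group Z] [Finite Z] (K : Type*) [Field K] :
    Finite (Z →* Kˣ) ∧ Nat.card (Z →* Kˣ) ≤ Nat.card Z := by
  have h := linearIndependent_monoidHom Z K
  have hinj : Function.Injective (fun f : Z →* Kˣ => (Units.coeHom K).comp f) := by
    intro f g hfg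
    ext z
    exact DFunLike.congr_fun hfg z
  have h' := h.comp _ hinj
  have := Fintype.ofFinite Z
  have hfin : Finite (Z →* Kˣ) := h'.finite_of_isNoetherian
  have := Fintype.ofFinite (Z →* Kˣ)
  refine ⟨hfin, ?_⟩
  have := h'.fintype_card_le_finrank
  rwa [Module.finrank_fintype_fun_eq_card, ← Nat.card_eq_fintype_card,
    ← Nat.card_eq_fintype_card] at this

/-- The image of `β` consists of characters of `Y` modulo the right kernel, and a finite group
has at most as many characters as elements. -/
theorem index_ker_le_index_ker_flip {X Y K : Type*} [Group X] [Group Y] [Finite Y] [Field K]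
    (β : X →* Y →* Kˣ) : β.ker.index ≤ β.flip.ker.index := by
  rw [index_ker]
  have hle : ∀ f ∈ β.range, β.flip.ker ≤ f.ker := by
    rintro f ⟨x, rfl⟩ y hy
    have : β.flip y x = 1 := by rw [MonoidHom.mem_ker.1 hy]; rfl
    simpa using this
  let j : β.range → (Y ⧸ β.flip.ker →* Kˣ) := fun f => QuotientGroup.lift _ f.1 (hle f.1 f.2)
  have hj : Function.Injective j := by
    intro f g hfg
    ext y
    have := DFunLike.congr_fun hfg (QuotientGroup.mk y)
    simpa [j] using congrArg Units.val this
  obtain ⟨hf, hc⟩ := card_monoidHom_units_le (Y ⧸ β.flip.ker) K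
  exact (Nat.card_le_card_of_injective j hj).trans (hc.trans_eq rfl)

theorem index_ker_eq_index_ker_flip {X Y K : Type*} [Group X] [Group Y] [Finite X] [Finite Y]
    [Field K] (β : X →* Y →* Kˣ) : β.ker.index = β.flip.ker.index :=
  le_antisymm (index_ker_le_index_ker_flip β) (index_ker_le_index_ker_flip β.flip)

/-- If `[X, Y] ≤ T` and `T` commutes with `X` and `Y`, commutators are multiplicative in both
arguments; a homomorphism out of `T` turns them into a pairing. -/
def commPairing {G M : Type*} [Group G] [CommGroup M] (T X Y : Subgroup G) (θ : T →* M)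
    (hX : ∀ x ∈ X, ∀ t ∈ T, x * t = t * x) (hY : ∀ y ∈ Y, ∀ t ∈ T, y * t = t * y)
    (hXY : ∀ x ∈ X, ∀ y ∈ Y, ⁅x, y⁆ ∈ T) : X →* Y →* M :=
  MonoidHom.mk' (fun x : X => MonoidHom.mk' (fun y : Y => θ ⟨⁅(x : G), (y : G)⁆, hXY x x.2 y y.2⟩)
    (by
      intro a b
      rw [← map_mul]
      congr 1
      ext
      have h := hY a a.2 _ (hXY x x.2 b b.2)
      have h2 : ⁅(x : G), (a * b : G)⁆ =
          ⁅(x : G), (a : G)⁆ * (a * ⁅(x : G), (b : G)⁆ * (a : G)⁻¹) := by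
        simp only [commutatorElement_def]; group
      simp only [coe_mul, h2, h, mul_inv_cancel_right]))
    (by
      intro a b
      ext y
      change θ _ = θ _ * θ _
      rw [← map_mul]
      congr 1
      ext
      have h := hX a a.2 _ (hXY b b.2 y y.2)
      have h1 := hX a a.2 _ (hXY a a.2 y y.2)
      have h2 : ⁅(a * b : G), (y : G)⁆ =
          (a * ⁅(b : G), (y : G)⁆ * (a : G)⁻¹) * ⁅(a : G), (y : G)⁆ := by
        simp only [commutatorElement_def]; group
      have h3 : ⁅(b : G), (y : G)⁆ * ⁅(a : G), (y : G)⁆ =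
          ⁅(a : G), (y : G)⁆ * ⁅(b : G), (y : G)⁆ := by
        have h4 := hX b b.2 _ (hXY a a.2 y y.2)
        have h5 := hY y y.2 _ (hXY a a.2 y y.2)
        have h6 : Commute ((b : G) * y * (b : G)⁻¹ * (y : G)⁻¹) ⁅(a : G), (y : G)⁆ :=
          ((Commute.mul_left (show Commute (b : G) _ from h4) h5).mul_left
            (Commute.inv_left h4)).mul_left (Commute.inv_left h5)
        exact h6
      simp only [coe_mul, h2, h, mul_inv_cancel_right, h3])

/-! ### Pairings with values in the units of a field -/

section Pairing

variable {U K : Type*} [CommGroup U] [Field K]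

/-- The restriction of a pairing to two subgroups. -/
def pairingRestrict (β : U →* U →* Kˣ) (H W : Subgroup U) : H →* W →* Kˣ :=
  ((β.comp H.subtype).flip.comp W.subtype).flip

/-- The elements orthogonal to every element of `H`. -/
def pairingPerp (β : U →* U →* Kˣ) (H : Subgroup U) : Subgroup U :=
  (β.comp H.subtype).flip.ker

theorem mem_pairingPerp {β : U →* U →* Kˣ} {H : Subgroup U} {u : U} :
    u ∈ pairingPerp β H ↔ ∀ h ∈ H, β h u = 1 := by
  simp only [pairingPerp, MonoidHom.mem_ker]
  constructor
  · intro h x hx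
    exact DFunLike.congr_fun h ⟨x, hx⟩
  · intro h
    ext x
    exact congrArg Units.val (h x x.2)

theorem pairing_swap {β : U →* U →* Kˣ} (halt : ∀ u, β u u = 1) (u v : U) :
    β u v = (β v u)⁻¹ := by
  have h := halt (u * v)
  simp only [map_mul, MonoidHom.mul_apply, halt, one_mul, mul_one] at h
  rw [eq_inv_iff_mul_eq_one, mul_comm]
  exact h

/-- If `β` is nondegenerate on `W`, then `|H| |Hᗮ ∩ W| = |W|`: the left and right kernels of the
pairing between `H` and `W` have equal index. -/
theorem card_inf_pairingPerp [Finite U] {β : U →* U →* Kˣ} {H W : Subgroup U} (hHW : H ≤ W)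
    (hrad : ∀ w ∈ W, (∀ w' ∈ W, β w w' = 1) → w = 1) :
    Nat.card H * Nat.card (pairingPerp β H ⊓ W : Subgroup U) = Nat.card W := by
  have hker : (pairingRestrict β H W).ker = ⊥ := by
    rw [eq_bot_iff]
    intro h hh
    rw [mem_bot]
    ext
    refine hrad h (hHW h.2) fun w hw => ?_
    exact DFunLike.congr_fun (MonoidHom.mem_ker.1 hh) ⟨w, hw⟩
  have hflip : (pairingRestrict β H W).flip.ker = (pairingPerp β H).subgroupOf W := by
    ext w
    rw [mem_subgroupOf, mem_pairingPerp, MonoidHom.mem_ker]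
    constructor
    · intro h x hx
      exact DFunLike.congr_fun h ⟨x, hx⟩
    · intro h
      ext x
      exact congrArg Units.val (h x x.2)
  have h := index_ker_eq_index_ker_flip (pairingRestrict β H W)
  rw [hker, hflip, index_bot] at h
  have h2 := card_mul_index ((pairingPerp β H).subgroupOf W)
  rw [← h, ← inf_subgroupOf_right,
    Nat.card_congr (subgroupOfEquivOfLe (inf_le_right : pairingPerp β H ⊓ W ≤ W)).toEquiv] at h2
  rw [mul_comm]; exact h2

/-- A maximal totally isotropic subgroup `H` of `W` is its own orthogonal complement in `W`, so
`|W| = |H| ^ 2`. -/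
theorem isSquare_card_of_alternating [Finite U] {β : U →* U →* Kˣ}
    (halt : ∀ u, β u u = 1) {W : Subgroup U}
    (hrad : ∀ w ∈ W, (∀ w' ∈ W, β w w' = 1) → w = 1) : IsSquare (Nat.card W) := by
  let S : Set (Subgroup U) := {H | H ≤ W ∧ H ≤ pairingPerp β H}
  have hS : S.Nonempty := ⟨⊥, bot_le, bot_le⟩
  obtain ⟨H, hH⟩ := (Set.toFinite S).exists_maximal hS
  have hself : pairingPerp β H ⊓ W = H := by
    refine le_antisymm (fun u hu => ?_) (le_inf hH.1.2 hH.1.1)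
    have hmem : H ⊔ zpowers u ∈ S := by
      refine ⟨sup_le hH.1.1 (zpowers_le.2 hu.2), fun x hx => mem_pairingPerp.2 fun y hy => ?_⟩
      obtain ⟨a, ha, b, hb, rfl⟩ := mem_sup.1 hx
      obtain ⟨c, hc, d, hd, rfl⟩ := mem_sup.1 hy
      obtain ⟨i, rfl⟩ := mem_zpowers_iff.1 hb
      obtain ⟨j, rfl⟩ := mem_zpowers_iff.1 hd
      have h1 := mem_pairingPerp.1 (hH.1.2 ha) c hc
      have h2 := mem_pairingPerp.1 hu.1 c hc
      have h3 : β u a = 1 := by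
        rw [pairing_swap halt, mem_pairingPerp.1 hu.1 a ha, inv_one]
      simp [h1, h2, h3, halt]
    exact hH.2 hmem le_sup_left (mem_sup_right (mem_zpowers u))
  have h := card_inf_pairingPerp hH.1.1 hrad
  rw [hself] at h
  exact ⟨_, h.symm⟩

end Pairing

/-- The pointwise stabilizer of a subgroup in the automorphism group. -/
def pointwiseFixer {U : Type*} [Group U] (H : Subgroup U) : Subgroup (MulAut U) where
  carrier := {b | ∀ h ∈ H, b h = h}
  one_mem' := fun _ _ => rfl
  mul_mem' := by
    intro a b ha hb h hh
    rw [MulAut.mul_apply, hb h hh, ha h hh]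
  inv_mem' := by
    intro a ha h hh
    conv_lhs => rw [← ha h hh]
    exact MulAut.inv_apply_self _ _ _

theorem pointwiseFixer_antitone {U : Type*} [Group U] : Antitone (pointwiseFixer (U := U)) :=
  fun _ _ h _ hb x hx => hb x (h hx)

section Bound

variable {U K : Type*} [CommGroup U] [Finite U] [Field K]

/-- An automorphism that preserves `β` and fixes `H` pointwise moves `y` within the coset of
`Hᗮ ∩ W` containing `y`, and `|Hᗮ ∩ W| = |W : H|`. -/
theorem relIndex_pointwiseFixer_step {β : U →* U →* Kˣ} {B : Subgroup (MulAut U)}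
    (hinv : ∀ b ∈ B, ∀ u v, β (b u) (b v) = β u v) {W H : Subgroup U}
    (hW : ∀ b ∈ B, ∀ w ∈ W, b w ∈ W)
    (hrad : ∀ w ∈ W, (∀ w' ∈ W, β w w' = 1) → w = 1) (hHW : H ≤ W) {y : U} (hy : y ∈ W) :
    (pointwiseFixer (H ⊔ zpowers y) ⊓ B).relIndex (pointwiseFixer H ⊓ B) ≤ H.relIndex W := by
  have hstab : (pointwiseFixer (H ⊔ zpowers y) ⊓ B).subgroupOf (pointwiseFixer H ⊓ B) =
      MulAction.stabilizer (pointwiseFixer H ⊓ B : Subgroup (MulAut U)) y := by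
    ext ⟨b, hb1, hb2⟩
    rw [mem_subgroupOf, MulAction.mem_stabilizer_iff]
    constructor
    · intro h
      exact h.1 y (mem_sup_right (mem_zpowers y))
    · intro h
      refine ⟨fun x hx => ?_, hb2⟩
      have h' : b y = y := h
      obtain ⟨a, ha, c, hc, rfl⟩ := mem_sup.1 hx
      obtain ⟨i, rfl⟩ := mem_zpowers_iff.1 hc
      rw [map_mul, map_zpow, h', hb1 a ha]
  rw [relIndex, hstab, MulAction.index_stabilizer]
  have hsub : MulAction.orbit (pointwiseFixer H ⊓ B : Subgroup (MulAut U)) y ⊆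
      (fun c => c * y) '' ((pairingPerp β H ⊓ W : Subgroup U) : Set U) := by
    rintro _ ⟨⟨b, hb1, hb2⟩, rfl⟩
    refine ⟨b y * y⁻¹, ⟨?_, W.mul_mem (hW b hb2 y hy) (W.inv_mem hy)⟩, by simp [MulAut.smul_def,
      Subgroup.smul_def]⟩
    refine mem_pairingPerp.2 fun h hh => ?_
    have h1 := hinv b hb2 h y
    rw [hb1 h hh] at h1
    rw [map_mul, map_inv, h1, mul_inv_cancel]
  have h1 := Set.ncard_le_ncard hsub (Set.toFinite _)
  have h2 := Set.ncard_image_le (f := fun c => c * y)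
    (Set.toFinite ((pairingPerp β H ⊓ W : Subgroup U) : Set U))
  have h3 : ((pairingPerp β H ⊓ W : Subgroup U) : Set U).ncard =
    Nat.card (pairingPerp β H ⊓ W : Subgroup U) := rfl
  have h4 := card_inf_pairingPerp hHW hrad
  have h5 := relIndex_mul_relIndex ⊥ H W bot_le hHW
  rw [relIndex_bot_left, relIndex_bot_left, ← h4] at h5
  have h6 := Nat.eq_of_mul_eq_mul_left Nat.card_pos h5
  omega

/-- Enlarging `H` one element at a time, the orbits have lengths at most
`p ^ k, p ^ (k - 1), …, p`. -/
theorem relIndex_pointwiseFixer_le {β : U →* U →* Kˣ} {B : Subgroup (MulAut U)}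
    (hinv : ∀ b ∈ B, ∀ u v, β (b u) (b v) = β u v) {W : Subgroup U}
    (hW : ∀ b ∈ B, ∀ w ∈ W, b w ∈ W)
    (hrad : ∀ w ∈ W, (∀ w' ∈ W, β w w' = 1) → w = 1) {p : ℕ} (hp : p.Prime) (k : ℕ) :
    ∀ H ≤ W, H.relIndex W = p ^ k →
      (pointwiseFixer W ⊓ B).relIndex (pointwiseFixer H ⊓ B) ≤ p ^ (k * (k + 1) / 2) := by
  induction k using Nat.strong_induction_on with
  | _ k ih =>
    intro H hHW hk
    by_cases hWH : W ≤ H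
    · have : H = W := le_antisymm hHW hWH
      subst this
      rw [relIndex_self]
      exact Nat.one_le_pow _ _ hp.pos
    · obtain ⟨y, hy, hyH⟩ := SetLike.not_le_iff_exists.1 hWH
      have hH'W : H ⊔ zpowers y ≤ W := sup_le hHW (zpowers_le.2 hy)
      have hmul := relIndex_mul_relIndex H (H ⊔ zpowers y) W le_sup_left hH'W
      have hne : H.relIndex (H ⊔ zpowers y) ≠ 1 := by
        rw [Ne, relIndex_eq_one]
        exact fun h => hyH (h (mem_sup_right (mem_zpowers y)))
      obtain ⟨j, hjk, hj⟩ := (Nat.dvd_prime_pow hp).1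
        (hk ▸ Dvd.intro_left _ hmul : (H ⊔ zpowers y).relIndex W ∣ p ^ k)
      have hlt : j < k := by
        refine lt_of_le_of_ne hjk fun h => hne ?_
        rw [hj, hk, h] at hmul
        exact Nat.eq_of_mul_eq_mul_right (Nat.pow_pos hp.pos) (by rw [hmul, one_mul])
      have h1 := ih j hlt _ hH'W hj
      have h2 := relIndex_pointwiseFixer_step hinv hW hrad hHW hy
      rw [hk] at h2
      have h3 := relIndex_mul_relIndex (pointwiseFixer W ⊓ B) (pointwiseFixer (H ⊔ zpowers y) ⊓ B)
        (pointwiseFixer H ⊓ B) (inf_le_inf_right _ (pointwiseFixer_antitone hH'W))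
        (inf_le_inf_right _ (pointwiseFixer_antitone le_sup_left))
      rw [← h3]
      refine (Nat.mul_le_mul h1 h2).trans ?_
      rw [← pow_add]
      refine Nat.pow_le_pow_right hp.pos ?_
      obtain ⟨k, rfl⟩ : ∃ l, k = l + 1 := ⟨k - 1, by omega⟩
      have h4 : j * (j + 1) ≤ k * (k + 1) := Nat.mul_le_mul (by omega) (by omega)
      have h5 : (k + 1) * (k + 1 + 1) = k * (k + 1) + (k + 1) * 2 := by ring
      rw [h5, Nat.add_mul_div_right _ _ (by norm_num)]
      exact Nat.add_le_add_right (Nat.div_le_div_right h4) _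

/-- In an abelian group of squarefree exponent the Sylow `p`-subgroup is the `p`-torsion. -/
theorem card_ker_powMonoidHom {U : Type*} [CommGroup U] [Finite U] {m : ℕ} (hm : Squarefree m)
    (hU : ∀ u : U, u ^ m = 1) {p : ℕ} (hp : p.Prime) :
    Nat.card (powMonoidHom p : U →* U).ker = p ^ (Nat.card U).factorization p := by
  have := Fact.mk hp
  let P : Sylow p U := default
  have : (powMonoidHom p : U →* U).ker = P := by
    apply le_antisymm
    · have hpg : IsPGroup p (powMonoidHom p : U →* U).ker := by
        rintro ⟨u, hu⟩
        refine ⟨1, ?_⟩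
        ext
        simpa using hu
      obtain ⟨Q, hQ⟩ := hpg.exists_le_sylow
      have : Unique (Sylow p U) := Sylow.unique_of_normal P inferInstance
      rwa [Subsingleton.elim Q P] at hQ
    · intro u hu
      obtain ⟨k, hk⟩ := P.2 ⟨u, hu⟩
      have hk' : u ^ p ^ k = 1 := congrArg Subtype.val hk
      have h1 : orderOf u ∣ p ^ k := orderOf_dvd_of_pow_eq_one hk'
      obtain ⟨j, -, hj⟩ := (Nat.dvd_prime_pow hp).1 h1
      have h2 : Squarefree (p ^ j) := hj ▸ hm.squarefree_of_dvd (orderOf_dvd_of_pow_eq_one (hU u))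
      have h3 : orderOf u ∣ p := by
        rw [hj]
        have : j ≤ 1 := by
          by_contra h
          have h5 : p * p ∣ p ^ j := by rw [← pow_two]; exact pow_dvd_pow _ (by omega)
          exact hp.one_lt.ne' (Nat.isUnit_iff.1 (h2 p h5))
        exact (pow_dvd_pow p this).trans (by simp)
      exact orderOf_dvd_iff_pow_eq_one.1 h3
  rw [this, P.card_eq_multiplicity]

theorem eq_top_of_forall_ker_powMonoidHom_le {U : Type*} [CommGroup U] [Finite U] {m : ℕ}
    (hm : Squarefree m) (hU : ∀ u : U, u ^ m = 1) (H : Subgroup U)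
    (hH : ∀ p ∈ (Nat.card U).primeFactors, (powMonoidHom p : U →* U).ker ≤ H) : H = ⊤ := by
  rw [← card_eq_iff_eq_top]
  apply Nat.dvd_antisymm (card_subgroup_dvd_card H)
  rw [← Nat.factorization_prime_le_iff_dvd Nat.card_pos.ne' Nat.card_pos.ne']
  intro p hp
  by_cases hpU : p ∈ (Nat.card U).primeFactors
  · rw [← hp.pow_dvd_iff_le_factorization Nat.card_pos.ne', ← card_ker_powMonoidHom hm hU hp]
    exact card_dvd_of_le (hH p hpU)
  · rw [← Nat.support_factorization, Finsupp.notMem_support_iff] at hpU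
    omega

end Bound

/-! ### Anisotropic actions -/

/-- The situation of a group `Γ` of automorphisms of a finite abelian group `U` with an
alternating pairing `β`: a normal subgroup `B` of `Γ` preserves the values of `β`, all of `Γ`
preserves orthogonality, and `β` is nondegenerate on every `Γ`-invariant subgroup. -/
structure IsAnisotropicAction {U K : Type*} [CommGroup U] [Field K] (β : U →* U →* Kˣ)
    (B Γ : Subgroup (MulAut U)) : Prop where
  alt : ∀ u, β u u = 1
  inv : ∀ b ∈ B, ∀ u v, β (b u) (b v) = β u v
  semi : ∀ g ∈ Γ, ∀ u v, β u v = 1 → β (g u) (g v) = 1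
  le : B ≤ Γ
  conj : ∀ g ∈ Γ, ∀ b ∈ B, g * b * g⁻¹ ∈ B
  anisotropic : ∀ W : Subgroup U, (∀ g ∈ Γ, ∀ w ∈ W, g w ∈ W) →
    ∀ w ∈ W, (∀ w' ∈ W, β w w' = 1) → w = 1

namespace IsAnisotropicAction

variable {U K : Type*} [CommGroup U] [Finite U] [Field K] {β : U →* U →* Kˣ}
  {B Γ : Subgroup (MulAut U)}

theorem isSquare_card (h : IsAnisotropicAction β B Γ) : IsSquare (Nat.card U) := by
  have := isSquare_card_of_alternating h.alt (W := ⊤)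
    (h.anisotropic ⊤ (fun _ _ _ _ => mem_top _))
  rwa [card_top] at this

/-- An automorphism is determined by its restrictions to the `p`-torsion subgroups of `U`, and on
each of these `B` is bounded by counting the orbits of a chain of pointwise stabilizers. -/
theorem card_le_prod (h : IsAnisotropicAction β B Γ) {m : ℕ} (hm : Squarefree m)
    (hU : ∀ u : U, u ^ m = 1) :
    Nat.card B ≤ ∏ p ∈ (Nat.card U).primeFactors,
      p ^ ((Nat.card U).factorization p * ((Nat.card U).factorization p + 1) / 2) := by
  let f : (Nat.card U).primeFactors → Subgroup (MulAut U) :=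
    fun p => pointwiseFixer (powMonoidHom (p : ℕ) : U →* U).ker
  have hbot : (⨅ p, f p) = ⊥ := by
    rw [eq_bot_iff]
    intro b hb
    rw [mem_bot]
    let E : Subgroup U := (b.toMonoidHom).eqLocus (MonoidHom.id U)
    have hE : E = ⊤ := by
      refine eq_top_of_forall_ker_powMonoidHom_le hm hU E fun p hp u hu => ?_
      exact (mem_iInf.1 hb ⟨p, hp⟩) u hu
    ext u
    have : u ∈ E := hE ▸ mem_top u
    exact this
  have h1 := relIndex_iInf_le (L := B) f
  rw [hbot, relIndex_bot_left] at h1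
  refine h1.trans ?_
  rw [← Finset.prod_coe_sort (Nat.card U).primeFactors (fun p =>
    p ^ ((Nat.card U).factorization p * ((Nat.card U).factorization p + 1) / 2))]
  refine Finset.prod_le_prod (fun _ _ => Nat.zero_le _) fun p _ => ?_
  have hp := Nat.prime_of_mem_primeFactors p.2
  have hinvt : ∀ g : MulAut U, ∀ w ∈ (powMonoidHom (p : ℕ) : U →* U).ker,
      g w ∈ (powMonoidHom (p : ℕ) : U →* U).ker := by
    intro g w hw
    rw [MonoidHom.mem_ker, powMonoidHom_apply] at hw ⊢
    rw [← map_pow, hw, map_one]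
  have h2 := relIndex_pointwiseFixer_le h.inv (W := (powMonoidHom (p : ℕ) : U →* U).ker)
    (fun b _ => hinvt b) (h.anisotropic _ fun g _ => hinvt g) hp
    ((Nat.card U).factorization p) ⊥ bot_le
    (by rw [relIndex_bot_left, card_ker_powMonoidHom hm hU hp])
  have h3 : pointwiseFixer (⊥ : Subgroup U) = ⊤ := by
    rw [eq_top_iff]
    intro b _ u hu
    rw [mem_bot.1 hu, map_one]
  rwa [h3, top_inf_eq, inf_relIndex_right] at h2

end IsAnisotropicAction

/-! ### Normal p-subgroups and fixed points of an anisotropic action -/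

/-- The subgroup of points fixed by every automorphism in `S`. -/
def fixedSubgroup {U : Type*} [Group U] (S : Subgroup (MulAut U)) : Subgroup U where
  carrier := {u | ∀ b ∈ S, b u = u}
  one_mem' := fun b _ => map_one b
  mul_mem' := by
    intro u v hu hv b hb
    rw [map_mul, hu b hb, hv b hb]
  inv_mem' := by
    intro u hu b hb
    rw [map_inv, hu b hb]

theorem mem_fixedSubgroup {U : Type*} [Group U] {S : Subgroup (MulAut U)} {u : U} :
    u ∈ fixedSubgroup S ↔ ∀ b ∈ S, b u = u := Iff.rfl

theorem mem_fixedSubgroup_zpowers {U : Type*} [Group U] {b : MulAut U} {u : U} :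
    u ∈ fixedSubgroup (zpowers b) ↔ b u = u := by
  rw [mem_fixedSubgroup]
  constructor
  · exact fun h => h b (mem_zpowers b)
  · intro h c hc
    have : zpowers b ≤ MulAction.stabilizer (MulAut U) u :=
      zpowers_le.2 (MulAction.mem_stabilizer_iff.2 h)
    exact MulAction.mem_stabilizer_iff.1 (this hc)

theorem card_modEq_card_inf_fixedSubgroup {U : Type*} [Group U] [Finite U] {p : ℕ}
    (hp : p.Prime) {S : Subgroup (MulAut U)} (hS : IsPGroup p S) {W : Subgroup U}
    (hW : ∀ b ∈ S, ∀ w ∈ W, b w ∈ W) :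
    Nat.card W ≡ Nat.card (fixedSubgroup S ⊓ W : Subgroup U) [MOD p] := by
  have := Fact.mk hp
  let _ : MulAction S W :=
    { smul := fun b w => ⟨(b : MulAut U) w, hW b b.2 w w.2⟩
      one_smul := fun w => rfl
      mul_smul := fun a b w => rfl }
  have h := hS.card_modEq_card_fixedPoints W
  have e : MulAction.fixedPoints S W ≃ (fixedSubgroup S ⊓ W : Subgroup U) :=
    { toFun := fun w => ⟨w.1, fun b hb => congrArg Subtype.val (w.2 ⟨b, hb⟩), w.1.2⟩
      invFun := fun u => ⟨⟨u.1, u.2.2⟩, fun b => Subtype.ext (u.2.1 b b.2)⟩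
      left_inv := fun w => rfl
      right_inv := fun w => rfl }
  rwa [Nat.card_congr e] at h

theorem eq_one_of_fixedSubgroup_zpowers_eq_top {U : Type*} [Group U] {b : MulAut U}
    (h : fixedSubgroup (zpowers b) = ⊤) : b = 1 := by
  ext u
  exact mem_fixedSubgroup_zpowers.1 (h ▸ mem_top u)

namespace IsAnisotropicAction

variable {U K : Type*} [CommGroup U] [Finite U] [Field K] {β : U →* U →* Kˣ}
  {B Γ : Subgroup (MulAut U)}

/-- The fixed points `W` of a normal `p`-subgroup form an invariant subgroup, and so does `Wᗮ`;
a `p`-group has nontrivial fixed points on `Wᗮ` unless `Wᗮ = 1`, but `W ∩ Wᗮ = 1`. -/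
theorem eq_bot_of_isPGroup (h : IsAnisotropicAction β B Γ) {p k : ℕ} (hp : p.Prime)
    (hU : Nat.card U = p ^ k) {P : Subgroup (MulAut U)} (hPΓ : P ≤ Γ)
    (hPn : ∀ g ∈ Γ, ∀ x ∈ P, g * x * g⁻¹ ∈ P) (hP : IsPGroup p P) : P = ⊥ := by
  have hfix : ∀ g ∈ Γ, ∀ u ∈ fixedSubgroup P, g u ∈ fixedSubgroup P := by
    intro g hg u hu x hx
    have h1 := hu _ (by simpa using hPn g⁻¹ (Γ.inv_mem hg) x hx : g⁻¹ * x * g ∈ P)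
    rw [MulAut.mul_apply, MulAut.mul_apply] at h1
    conv_rhs => rw [← h1]
    exact (MulAut.apply_inv_self _ g _).symm
  have hperp : ∀ g ∈ Γ, ∀ u ∈ pairingPerp β (fixedSubgroup P),
      g u ∈ pairingPerp β (fixedSubgroup P) := by
    intro g hg u hu
    refine mem_pairingPerp.2 fun w hw => ?_
    have h1 := mem_pairingPerp.1 hu _ (hfix g⁻¹ (Γ.inv_mem hg) w hw)
    have h2 := h.semi g hg _ _ h1
    rwa [MulAut.apply_inv_self] at h2
  have hinf : fixedSubgroup P ⊓ pairingPerp β (fixedSubgroup P) = ⊥ := by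
    rw [eq_bot_iff]
    rintro w ⟨hw1, hw2⟩
    refine h.anisotropic _ hfix w hw1 fun w' hw' => ?_
    rw [pairing_swap h.alt, mem_pairingPerp.1 hw2 w' hw', inv_one]
  have hmod := card_modEq_card_inf_fixedSubgroup hp hP
    (fun b hb => hperp b (hPΓ hb) : ∀ b ∈ P, ∀ w ∈ pairingPerp β (fixedSubgroup P), _)
  rw [hinf, card_bot] at hmod
  have hcard := card_inf_pairingPerp (β := β) (H := fixedSubgroup P) le_top
    (h.anisotropic ⊤ (fun _ _ _ _ => mem_top _))
  rw [inf_top_eq, card_top] at hcard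
  obtain ⟨j, -, hj⟩ := (Nat.dvd_prime_pow hp).1 (hU ▸ hcard ▸ Dvd.intro_left _ rfl :
    Nat.card (pairingPerp β (fixedSubgroup P)) ∣ p ^ k)
  have hj0 : j = 0 := by
    by_contra hne
    rw [hj] at hmod
    have h1 := (Nat.modEq_iff_dvd' (Nat.one_le_pow _ _ hp.pos)).1 hmod.symm
    have h2 := (Nat.dvd_sub_iff_right (Nat.one_le_pow _ _ hp.pos) (dvd_pow_self p hne)).1 h1
    exact hp.one_lt.ne' (Nat.dvd_one.1 h2)
  rw [hj, hj0, pow_zero, mul_one, card_eq_iff_eq_top] at hcard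
  rw [eq_bot_iff]
  intro x hx
  rw [mem_bot]
  ext u
  exact (hcard ▸ mem_top u : u ∈ fixedSubgroup P) x hx

/-- For an automorphism `b` of order prime to `|U|` the group `U` is the orthogonal sum of the
fixed points of `b` and of the commutators `[U, b]`, so the pairing is nondegenerate on the
fixed points. -/
theorem isSquare_card_fixedSubgroup (h : IsAnisotropicAction β B Γ) {b : MulAut U} (hb : b ∈ B)
    {n : ℕ} (hn : b ^ n = 1) (hcop : n.Coprime (Nat.card U)) :
    IsSquare (Nat.card (fixedSubgroup (zpowers b))) := by
  let δ : U →* U := b.toMonoidHom / MonoidHom.id U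
  have hδ : ∀ u, δ u = b u / u := fun u => rfl
  have hker : δ.ker = fixedSubgroup (zpowers b) := by
    ext u
    rw [MonoidHom.mem_ker, hδ, div_eq_one, mem_fixedSubgroup_zpowers]
  have hdisj : Disjoint δ.ker δ.range := by
    rw [disjoint_iff, eq_bot_iff]
    rintro _ ⟨hc, u, rfl⟩
    rw [hker] at hc
    replace hc := mem_fixedSubgroup_zpowers.1 (show δ u ∈ fixedSubgroup (zpowers b) from hc)
    have hpow : ∀ i : ℕ, (b ^ i) u = u * δ u ^ i := by
      intro i
      induction i with
      | zero => simp
      | succ i ih =>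
        rw [pow_succ', MulAut.mul_apply, ih, map_mul, map_pow, hc, pow_succ', ← mul_assoc, hδ]
        rw [mul_div_cancel]
    have h1 := hpow n
    rw [hn, MulAut.one_apply, left_eq_mul] at h1
    have h2 : δ u ^ Nat.card U = 1 := pow_card_eq_one'
    rw [mem_bot]
    have h3 := Nat.dvd_gcd (orderOf_dvd_of_pow_eq_one h1) (orderOf_dvd_of_pow_eq_one h2)
    rw [hcop.gcd_eq_one, Nat.dvd_one, orderOf_eq_one_iff] at h3
    exact h3
  have hcard : Nat.card δ.ker * Nat.card δ.range = Nat.card U := by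
    rw [← index_ker, card_mul_index]
  have hsup := (isComplement'_of_card_mul_and_disjoint hcard hdisj).sup_eq_top
  rw [← hker]
  refine isSquare_card_of_alternating h.alt fun w hw hperp => ?_
  refine h.anisotropic ⊤ (fun _ _ _ _ => mem_top _) w (mem_top w) fun v _ => ?_
  obtain ⟨c, hc, _, ⟨u, rfl⟩, rfl⟩ := mem_sup.1 (hsup ▸ mem_top v : v ∈ δ.ker ⊔ δ.range)
  rw [map_mul, hperp c hc, one_mul, hδ, map_div, div_eq_one]
  rw [hker, mem_fixedSubgroup_zpowers] at hw
  conv_lhs => rw [← hw]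
  exact h.inv b hb w u

/-- The constraints on the number of fixed points of a nontrivial `ℓ`-element of `B`, for a prime
`ℓ` not dividing `|U|`. -/
theorem card_fixedSubgroup_of_pow_prime (h : IsAnisotropicAction β B Γ) {ℓ j : ℕ} (hℓ : ℓ.Prime)
    (hcop : ℓ.Coprime (Nat.card U)) {b : MulAut U} (hb : b ∈ B) (hj : b ^ ℓ ^ j = 1)
    (hb1 : b ≠ 1) :
    IsSquare (Nat.card (fixedSubgroup (zpowers b))) ∧
      Nat.card (fixedSubgroup (zpowers b)) ∣ Nat.card U ∧
      Nat.card (fixedSubgroup (zpowers b)) ≠ Nat.card U ∧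
      Nat.card (fixedSubgroup (zpowers b)) ≡ Nat.card U [MOD ℓ] := by
  refine ⟨h.isSquare_card_fixedSubgroup hb hj (hcop.pow_left j), card_subgroup_dvd_card _,
    fun hc => hb1 (eq_one_of_fixedSubgroup_zpowers_eq_top (card_eq_iff_eq_top _ |>.1 hc)), ?_⟩
  have hp : IsPGroup ℓ (zpowers b) := by
    rintro ⟨_, i, rfl⟩
    refine ⟨j, Subtype.ext ?_⟩
    change (b ^ i) ^ ℓ ^ j = 1
    rw [← zpow_natCast, ← zpow_mul, mul_comm, zpow_mul, zpow_natCast, hj, one_zpow]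
  have := card_modEq_card_inf_fixedSubgroup hℓ hp (W := ⊤) (fun _ _ _ _ => mem_top _)
  rw [inf_top_eq, card_top] at this
  exact this.symm

/-- The hypothesis `hw` says that a nontrivial `ℓ`-element of `B` fixes exactly `w` points. If
`ℓ ^ 2` divided `|B|`, counting the orbits of a subgroup of order `ℓ ^ 2` by Burnside's lemma would
make `|U| + (ℓ ^ 2 - 1) * w` divisible by `ℓ ^ 2`. -/
theorem not_sq_dvd_card (h : IsAnisotropicAction β B Γ) {ℓ : ℕ} (hℓ : ℓ.Prime)
    (hcop : ℓ.Coprime (Nat.card U)) (w : ℕ)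
    (hw : ∀ c, c ∣ Nat.card U → IsSquare c → c ≠ Nat.card U → c ≡ Nat.card U [MOD ℓ] → c = w)
    (hnd : ¬ ℓ ^ 2 ∣ Nat.card U + (ℓ ^ 2 - 1) * w) : ¬ ℓ ^ 2 ∣ Nat.card B := by
  classical
  intro hdvd
  have := Fact.mk hℓ
  obtain ⟨S, hS⟩ := Sylow.exists_subgroup_card_pow_prime ℓ hdvd
  have := Fintype.ofFinite U
  have := Fintype.ofFinite S
  have := Fintype.ofFinite (Quotient (MulAction.orbitRel S U))
  have := fun s : S => Fintype.ofFinite (MulAction.fixedBy U s)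
  have hB := MulAction.sum_card_fixedBy_eq_card_orbits_mul_card_group S U
  have hcardS : Fintype.card S = ℓ ^ 2 := by rw [← Nat.card_eq_fintype_card, hS]
  have h1 : ∀ s : S, s ≠ 1 → Fintype.card (MulAction.fixedBy U s) = w := by
    intro s hs
    have hs1 : ((s : B) : MulAut U) ≠ 1 := fun hh => hs (Subtype.ext (Subtype.ext hh))
    have hpow : ((s : B) : MulAut U) ^ ℓ ^ 2 = 1 := by
      have : s ^ ℓ ^ 2 = 1 := by rw [← hS]; exact pow_card_eq_one'
      exact congrArg (fun x : S => ((x : B) : MulAut U)) this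
    obtain ⟨a1, a2, a3, a4⟩ := h.card_fixedSubgroup_of_pow_prime hℓ hcop (s : B).2 hpow hs1
    rw [← hw _ a2 a1 a3 a4, ← Nat.card_eq_fintype_card]
    refine Nat.card_congr (Equiv.subtypeEquivRight fun u => ?_)
    rw [mem_fixedSubgroup_zpowers]
    exact Iff.rfl
  rw [← Finset.add_sum_erase _ _ (Finset.mem_univ (1 : S)),
    Finset.sum_congr rfl (fun s hs => h1 s (Finset.ne_of_mem_erase hs)), Finset.sum_const,
    Finset.card_erase_of_mem (Finset.mem_univ _), Finset.card_univ, hcardS, smul_eq_mul] at hB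
  have h2 : Fintype.card (MulAction.fixedBy U (1 : S)) = Nat.card U := by
    rw [← Nat.card_eq_fintype_card]
    refine Nat.card_congr ((Equiv.subtypeUnivEquiv fun u => ?_))
    exact one_smul S u
  rw [h2] at hB
  exact hnd ⟨_, hB.trans (mul_comm _ _)⟩

/-- For `|U| = 9` the numbers of fixed points leave `3` as the only odd prime divisor of `|Γ|`.
Then `Γ` fixes some `u ≠ 1`, and the alternating pairing vanishes on the invariant subgroup
generated by `u`. -/
theorem card_ne_nine (h : IsAnisotropicAction β B Γ) (hodd : Odd (Nat.card Γ)) :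
    Nat.card U ≠ 9 := by
  intro hU
  have hfix : ∀ c, c ∣ 9 → c ≠ 9 → c = 1 ∨ c = 3 := by
    intro c hc hc9
    have : c ≤ 9 := Nat.le_of_dvd (by norm_num) hc
    interval_cases c <;> omega
  have hp : IsPGroup 3 Γ := by
    rw [IsPGroup.iff_card]
    refine ⟨_, Nat.eq_prime_pow_of_unique_prime_dvd Nat.card_pos.ne' fun {ℓ} hℓ hdvd => ?_⟩
    by_contra hℓ3
    have := Fact.mk hℓ
    obtain ⟨g, hg⟩ := exists_prime_orderOf_dvd_card' ℓ hdvd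
    have hg1 : (g : MulAut U) ≠ 1 := fun hh => by
      have : g = 1 := Subtype.ext hh
      rw [this, orderOf_one] at hg
      exact hℓ.one_lt.ne hg
    have hpg : IsPGroup ℓ (zpowers (g : MulAut U)) := by
      refine IsPGroup.of_card (n := 1) ?_
      rw [Nat.card_zpowers, orderOf_coe, hg, pow_one]
    have hmod := card_modEq_card_inf_fixedSubgroup hℓ hpg (W := ⊤) (fun _ _ _ _ => mem_top _)
    rw [inf_top_eq, card_top, hU] at hmod
    have hne : Nat.card (fixedSubgroup (zpowers (g : MulAut U))) ≠ 9 := fun hc =>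
      hg1 (eq_one_of_fixedSubgroup_zpowers_eq_top (card_eq_iff_eq_top _ |>.1 (hc.trans hU.symm)))
    have hodd' : Odd ℓ := hodd.of_dvd_nat hdvd
    have key : ∀ d, d ∣ 8 ∨ d ∣ 6 → d.Prime → Odd d → d = 3 := by
      intro d hd hdp hdo
      have : d ≤ 8 := by
        rcases hd with hd | hd
        · exact Nat.le_of_dvd (by norm_num) hd
        · exact (Nat.le_of_dvd (by norm_num) hd).trans (by norm_num)
      interval_cases d <;> first | rfl | (exfalso; revert hd hdp hdo; decide)
    refine hℓ3 (key ℓ ?_ hℓ hodd')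
    rcases hfix _ (hU ▸ card_subgroup_dvd_card _) hne with hc | hc <;> rw [hc] at hmod
    · exact Or.inl ((Nat.modEq_iff_dvd' (by norm_num)).1 hmod.symm)
    · exact Or.inr ((Nat.modEq_iff_dvd' (by norm_num)).1 hmod.symm)
  have hmod := card_modEq_card_inf_fixedSubgroup Nat.prime_three hp (W := ⊤)
    (fun _ _ _ _ => mem_top _)
  rw [inf_top_eq, card_top, hU] at hmod
  have hne1 : fixedSubgroup Γ ≠ ⊥ := by
    intro hb
    rw [hb, card_bot] at hmod
    exact absurd hmod (by decide)
  obtain ⟨u, hu, hu1⟩ := (fixedSubgroup Γ).ne_bot_iff_exists_ne_one.1 hne1 |>.elim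
    (fun a ha => (⟨a.1, a.2, fun hh => ha (Subtype.ext hh)⟩ :
      ∃ u, u ∈ fixedSubgroup Γ ∧ u ≠ 1))
  refine hu1 (h.anisotropic (zpowers u) ?_ u (mem_zpowers u) ?_)
  · rintro g hg _ ⟨i, rfl⟩
    refine ⟨i, ?_⟩
    change u ^ i = g (u ^ i)
    rw [map_zpow, hu g hg]
  · rintro _ ⟨i, rfl⟩
    change β u (u ^ i) = 1
    rw [map_zpow, h.alt, one_zpow]

end IsAnisotropicAction

/-! ### Self-centralizing normal subgroups and cyclic normal subgroups -/

theorem isCyclic_of_squarefree_card {G : Type*} [CommGroup G] [Finite G]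
    (h : Squarefree (Nat.card G)) : IsCyclic G := by
  have : IsZGroup G := IsZGroup.of_squarefree h
  infer_instance

/-- If `M / N` has prime order and `N` is central in `M`, then `M` is commutative. -/
theorem mul_comm_of_relIndex_prime {G : Type*} [Group G] {N M : Subgroup G}
    (hcen : ∀ n ∈ N, ∀ m ∈ M, n * m = m * n) {ℓ : ℕ} (hℓ : ℓ.Prime)
    (hidx : N.relIndex M = ℓ) : ∀ x ∈ M, ∀ y ∈ M, x * y = y * x := by
  have := Fact.mk hℓ
  have hn : (N.subgroupOf M).Normal := by
    refine ⟨fun n hn g => ?_⟩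
    have h1 := hcen n hn g g.2
    have : g * n * g⁻¹ = n := by
      rw [mul_inv_eq_iff_eq_mul]
      exact Subtype.ext h1.symm
    rwa [this]
  have hcyc : IsCyclic (M ⧸ N.subgroupOf M) := by
    refine isCyclic_of_prime_card (p := ℓ) ?_
    rw [← index_eq_card]; exact hidx
  have hc := (QuotientGroup.mk' (N.subgroupOf M)).isMulCommutative_of_isCyclic_of_ker_le_center
    (by
      rw [QuotientGroup.ker_mk']
      intro n hn
      rw [mem_center_iff]
      intro g
      exact Subtype.ext (hcen n hn g g.2).symm)
  intro x hx y hy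
  exact congrArg Subtype.val (hc.is_comm.comm (⟨x, hx⟩ : M) ⟨y, hy⟩)

/-- A maximal commutative `Γ`-normal subgroup `N` below `B` is self-centralizing in `B`, provided
that `B` has no nontrivial `Γ`-normal `p`-subgroup and that `ℓ ^ 2` does not divide `|B|` for primes
`ℓ ≠ p`. Otherwise there is an elementary abelian section `M / N` of `C_B(N)`, and `M` turns out to
be commutative. -/
theorem exists_normal_commutative_self_centralizing {Γ : Type*} [Group Γ] [Finite Γ]
    (hΓ : Group.IsSolvable Γ) (B : Subgroup Γ) [hBn : B.Normal] {p : ℕ} (hp : p.Prime)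
    (hO : ∀ P : Subgroup Γ, P.Normal → P ≤ B → IsPGroup p P → P = ⊥)
    (hsq : ∀ ℓ : ℕ, ℓ.Prime → ℓ ≠ p → ¬ ℓ ^ 2 ∣ Nat.card B) :
    ∃ N : Subgroup Γ, N.Normal ∧ N ≤ B ∧ (∀ x ∈ N, ∀ y ∈ N, x * y = y * x) ∧
      ¬ p ∣ Nat.card N ∧ ∀ b ∈ B, (∀ x ∈ N, x * b = b * x) → b ∈ N := by
  let S : Set (Subgroup Γ) := {N | N.Normal ∧ N ≤ B ∧ ∀ x ∈ N, ∀ y ∈ N, x * y = y * x}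
  have hS : S.Nonempty := ⟨⊥, inferInstance, bot_le, fun x hx y hy => by
    rw [mem_bot.1 hx, mem_bot.1 hy]⟩
  obtain ⟨N, ⟨hNn, hNB, hNc⟩, hmax⟩ := (Set.toFinite S).exists_maximal hS
  have hpN : ¬ p ∣ Nat.card N := by
    intro hd
    have := Fact.mk hp
    obtain ⟨x, hx⟩ := exists_prime_orderOf_dvd_card' p hd
    have hP : N.powTorsion hNc p = ⊥ := by
      refine hO _ (N.powTorsion_normal hNc p) (fun y hy => hNB hy.1) ?_
      rintro ⟨y, hy⟩
      exact ⟨1, Subtype.ext (by simpa using hy.2)⟩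
    have hxm : (x : Γ) ∈ N.powTorsion hNc p :=
      ⟨x.2, by rw [← hx, ← orderOf_coe, pow_orderOf_eq_one]⟩
    rw [hP, mem_bot] at hxm
    have h1 : orderOf (x : Γ) = p := by rw [orderOf_coe, hx]
    rw [hxm, orderOf_one] at h1
    exact hp.one_lt.ne h1
  refine ⟨N, hNn, hNB, hNc, hpN, fun b hb hcb => ?_⟩
  by_contra hbN
  have hNC : N ≤ B ⊓ centralizer (N : Set Γ) :=
    le_inf hNB fun x hx => mem_centralizer_iff.2 fun y hy => hNc y hy x hx
  have hlt : N < B ⊓ centralizer (N : Set Γ) :=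
    lt_of_le_of_ne hNC fun he => hbN (he ▸ ⟨hb, mem_centralizer_iff.2 hcb⟩)
  obtain ⟨ℓ, M, hℓ, hMn, hNM, hMC, hMT, hMp⟩ := exists_normal_elementary_abelian_between hΓ N
    (B ⊓ centralizer (N : Set Γ)) hlt
  have hcen : ∀ n ∈ N, ∀ m ∈ M, n * m = m * n := fun n hn m hm =>
    mem_centralizer_iff.1 (hMC hm).2 n hn
  suffices hMc : ∀ x ∈ M, ∀ y ∈ M, x * y = y * x from
    hNM.not_ge (hmax ⟨hMn, fun x hx => (hMC hx).1, hMc⟩ hNM.le)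
  by_cases hℓp : ℓ = p
  · -- commutators lie in `N` and have order dividing `p`, which is prime to `|N|`
    subst hℓp
    intro x hx y hy
    have hz := hMT x hx y hy
    have hcomm : ∀ i : ℕ, ⁅x ^ i, y⁆ = ⁅x, y⁆ ^ i := by
      intro i
      induction i with
      | zero => simp
      | succ i ih =>
        have h1 : ⁅x ^ (i + 1), y⁆ = x * ⁅x ^ i, y⁆ * x⁻¹ * ⁅x, y⁆ := by
          simp only [commutatorElement_def, pow_succ']; group
        have h2 := hcen _ (N.pow_mem hz i) x hx
        rw [h1, ih, ← h2, mul_inv_cancel_right, ← pow_succ]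
    have h1 : ⁅x, y⁆ ^ ℓ = 1 := by
      rw [← hcomm, commutatorElement_eq_one_iff_mul_comm]
      exact hcen _ (hMp x hx) y hy
    have h2 : orderOf ⁅x, y⁆ ∣ Nat.card N := orderOf_dvd_natCard N hz
    have h3 : orderOf ⁅x, y⁆ ∣ ℓ := orderOf_dvd_of_pow_eq_one h1
    rw [← commutatorElement_eq_one_iff_mul_comm, ← orderOf_eq_one_iff]
    rcases (Nat.dvd_prime hℓ).1 h3 with h4 | h4
    · exact h4
    · exact absurd (h4 ▸ h2) hpN
  · have hMB : M ≤ B := fun x hx => (hMC hx).1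
    -- `M / N` is an elementary abelian `ℓ`-group, and `ℓ ^ 2` does not divide its order
    have hnorm : (N.subgroupOf M).Normal := hNn.subgroupOf M
    have hpg : IsPGroup ℓ (M ⧸ N.subgroupOf M) := by
      intro q
      obtain ⟨m, rfl⟩ := QuotientGroup.mk_surjective q
      refine ⟨1, ?_⟩
      rw [pow_one, ← QuotientGroup.mk_pow, QuotientGroup.eq_one_iff]
      exact hMp m m.2
    have := Fact.mk hℓ
    obtain ⟨k, hk⟩ := IsPGroup.iff_card.1 hpg
    rw [← index_eq_card] at hk
    change N.relIndex M = ℓ ^ k at hk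
    have hkd : ℓ ^ k ∣ Nat.card B := hk ▸ (relIndex_dvd_card N M).trans (card_dvd_of_le hMB)
    have hk2 : k < 2 := by
      by_contra hh
      exact hsq ℓ hℓ hℓp ((pow_dvd_pow ℓ (by omega)).trans hkd)
    have hk0 : k ≠ 0 := by
      rintro rfl
      rw [pow_zero, relIndex_eq_one] at hk
      exact hNM.not_ge hk
    have hk1 : k = 1 := by omega
    rw [hk1, pow_one] at hk
    exact mul_comm_of_relIndex_prime hcen hℓ hk

/-- The self-centralizing subgroup is cyclic of squarefree order `n`, and the quotient by it embeds
in its automorphism group, which has order `φ n`. -/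
theorem exists_card_subgroup_eq_mul_dvd_totient {Γ : Type*} [Group Γ] [Finite Γ]
    (hΓ : Group.IsSolvable Γ) (B : Subgroup Γ) [hBn : B.Normal] {p : ℕ} (hp : p.Prime)
    (hO : ∀ P : Subgroup Γ, P.Normal → P ≤ B → IsPGroup p P → P = ⊥)
    (hsq : ∀ ℓ : ℕ, ℓ.Prime → ℓ ≠ p → ¬ ℓ ^ 2 ∣ Nat.card B) :
    ∃ n r : ℕ, n ∣ Nat.card B ∧ Squarefree n ∧ ¬ p ∣ n ∧ r ∣ n.totient ∧
      Nat.card B = n * r := by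
  obtain ⟨N, hNn, hNB, hNc, hpN, hself⟩ :=
    exists_normal_commutative_self_centralizing hΓ B hp hO hsq
  have hdvd := card_dvd_of_le hNB
  have hsf : Squarefree (Nat.card N) := by
    rw [Nat.squarefree_iff_prime_squarefree]
    intro ℓ hℓ hd
    by_cases hℓp : ℓ = p
    · exact hpN (hℓp ▸ (Dvd.intro _ rfl).trans hd)
    · exact hsq ℓ hℓ hℓp ((pow_two ℓ ▸ hd).trans hdvd)
  let _ : CommGroup N := { (inferInstance : Group N) with
    mul_comm := fun a b => Subtype.ext (hNc a a.2 b b.2) }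
  have hcyc : IsCyclic N := isCyclic_of_squarefree_card hsf
  let c : B →* MulAut N := MulAut.conjNormal.comp B.subtype
  have hker : c.ker = N.subgroupOf B := by
    ext b
    rw [MonoidHom.mem_ker, mem_subgroupOf]
    have key : c b = 1 ↔ ∀ x ∈ N, x * b = b * x := by
      constructor
      · intro h x hx
        have h1 := congrArg Subtype.val (DFunLike.congr_fun h ⟨x, hx⟩)
        have h2 : (b : Γ) * x * (b : Γ)⁻¹ = x := h1
        exact (mul_inv_eq_iff_eq_mul.1 h2).symm
      · intro h
        ext x
        change (b : Γ) * x * (b : Γ)⁻¹ = x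
        rw [← h x x.2, mul_inv_cancel_right]
    rw [key]
    exact ⟨hself b b.2, fun hb x hx => hNc x hx b hb⟩
  refine ⟨Nat.card N, N.relIndex B, hdvd, hsf, hpN, ?_, ?_⟩
  · rw [← IsCyclic.card_mulAut N, relIndex, ← hker, index_ker]
    exact card_subgroup_dvd_card _
  · have := relIndex_mul_relIndex ⊥ N B bot_le hNB
    rw [relIndex_bot_left, relIndex_bot_left] at this
    exact this.symm

namespace IsAnisotropicAction

variable {U K : Type*} [CommGroup U] [Finite U] [Field K] {β : U →* U →* Kˣ}
  {B Γ : Subgroup (MulAut U)}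

theorem exists_card_eq_mul_dvd_totient (h : IsAnisotropicAction β B Γ)
    (hΓ : Group.IsSolvable Γ) {p k : ℕ} (hp : p.Prime) (hU : Nat.card U = p ^ k)
    (hsq : ∀ ℓ : ℕ, ℓ.Prime → ℓ ≠ p → ¬ ℓ ^ 2 ∣ Nat.card B) :
    ∃ n r : ℕ, n ∣ Nat.card B ∧ Squarefree n ∧ ¬ p ∣ n ∧ r ∣ n.totient ∧
      Nat.card B = n * r := by
  have hcard : Nat.card (B.subgroupOf Γ) = Nat.card B :=
    Nat.card_congr (subgroupOfEquivOfLe h.le).toEquiv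
  have hn : (B.subgroupOf Γ).Normal := ⟨fun b hb g => h.conj g g.2 b hb⟩
  rw [← hcard] at hsq ⊢
  refine exists_card_subgroup_eq_mul_dvd_totient hΓ (B.subgroupOf Γ) hp (fun P hPn hPB hP => ?_) hsq
  have h1 := h.eq_bot_of_isPGroup hp hU (P := P.map Γ.subtype) (map_subtype_le P)
    (by
      rintro g hg _ ⟨x, hx, rfl⟩
      exact ⟨⟨g, hg⟩ * x * ⟨g, hg⟩⁻¹, hPn.conj_mem x hx ⟨g, hg⟩, rfl⟩)
    (hP.map _)
  rwa [Subgroup.map_eq_bot_iff, ker_subtype, le_bot_iff] at h1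

/-- Here `L` contains the primes `ℓ ≠ p` that the numbers of fixed points permit as divisors of
`|B|`, and `w ℓ` is the number of fixed points of an `ℓ`-element; `hnd` is what excludes `ℓ ^ 2`. -/
theorem exists_card_eq_mul_dvd_totient_of_fixed (h : IsAnisotropicAction β B Γ)
    (hΓ : Group.IsSolvable Γ) (hodd : Odd (Nat.card Γ)) {p k : ℕ} (hp : p.Prime)
    (hU : Nat.card U = p ^ k) {L : Finset ℕ} (w : ℕ → ℕ)
    (hw : ∀ ℓ : ℕ, ℓ.Prime → Odd ℓ → ℓ ≠ p → ∀ c, c ∣ p ^ k → IsSquare c → c ≠ p ^ k →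
      c ≡ p ^ k [MOD ℓ] → ℓ ∈ L ∧ c = w ℓ)
    (hnd : ∀ ℓ ∈ L, ¬ ℓ ^ 2 ∣ p ^ k + (ℓ ^ 2 - 1) * w ℓ) :
    ∃ n r : ℕ, (∀ ℓ : ℕ, ℓ.Prime → ℓ ∣ n → ℓ ∈ L) ∧ Squarefree n ∧ r ∣ n.totient ∧ Odd r ∧
      Nat.card B = n * r := by
  have hoddB : Odd (Nat.card B) := hodd.of_dvd_nat (card_dvd_of_le h.le)
  have hcop : ∀ ℓ : ℕ, ℓ.Prime → ℓ ≠ p → ℓ.Coprime (Nat.card U) := fun ℓ hℓ hne => by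
    rw [hU]
    exact ((Nat.coprime_primes hℓ hp).2 hne).pow_right k
  have hmem : ∀ ℓ : ℕ, ℓ.Prime → ℓ ≠ p → ℓ ∣ Nat.card B → ℓ ∈ L := by
    intro ℓ hℓ hne hd
    have := Fact.mk hℓ
    obtain ⟨b, hb⟩ := exists_prime_orderOf_dvd_card' ℓ hd
    have hb1 : (b : MulAut U) ≠ 1 := fun hh => by
      have : b = 1 := Subtype.ext hh
      rw [this, orderOf_one] at hb
      exact hℓ.one_lt.ne hb
    have hpow : (b : MulAut U) ^ ℓ ^ 1 = 1 := by
      rw [pow_one, ← hb, ← orderOf_coe, pow_orderOf_eq_one]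
    obtain ⟨a1, a2, a3, a4⟩ := h.card_fixedSubgroup_of_pow_prime hℓ (hcop ℓ hℓ hne) b.2 hpow hb1
    rw [hU] at a2 a3 a4
    exact (hw ℓ hℓ (hoddB.of_dvd_nat hd) hne _ a2 a1 a3 a4).1
  have hsq : ∀ ℓ : ℕ, ℓ.Prime → ℓ ≠ p → ¬ ℓ ^ 2 ∣ Nat.card B := by
    intro ℓ hℓ hne hd
    have hd1 : ℓ ∣ Nat.card B := (dvd_pow_self ℓ two_ne_zero).trans hd
    refine h.not_sq_dvd_card hℓ (hcop ℓ hℓ hne) (w ℓ) (fun c c1 c2 c3 c4 => ?_) ?_ hd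
    · rw [hU] at c1 c3 c4
      exact (hw ℓ hℓ (hoddB.of_dvd_nat hd1) hne c c1 c2 c3 c4).2
    · rw [hU]
      exact hnd ℓ (hmem ℓ hℓ hne hd1)
  obtain ⟨n, r, hn, hsf, hpn, hr, hcard⟩ := h.exists_card_eq_mul_dvd_totient hΓ hp hU hsq
  refine ⟨n, r, fun ℓ hℓ hd => hmem ℓ hℓ (fun hh => hpn (hh ▸ hd)) (hd.trans hn), hsf, hr,
    hoddB.of_dvd_nat (hcard ▸ Dvd.intro_left _ rfl), hcard⟩

end IsAnisotropicAction

/-! ### Acting groups of modules of small order -/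

theorem Nat.dvd_prod_of_squarefree {n : ℕ} {L : Finset ℕ} (hn : Squarefree n)
    (hL : ∀ ℓ : ℕ, ℓ.Prime → ℓ ∣ n → ℓ ∈ L) : n ∣ ∏ ℓ ∈ L, ℓ := by
  conv_lhs => rw [← Nat.prod_primeFactors_of_squarefree hn]
  exact Finset.prod_dvd_prod_of_subset _ _ _ fun ℓ hℓ =>
    hL ℓ (Nat.prime_of_mem_primeFactors hℓ) (Nat.dvd_of_mem_primeFactors hℓ)

namespace IsAnisotropicAction

variable {U K : Type*} [CommGroup U] [Finite U] [Field K] {β : U →* U →* Kˣ}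
  {B Γ : Subgroup (MulAut U)}

/-- The order of `B` is `n * r`, where `n` divides the product of the primes in `L` and `r` is an
odd divisor of `φ n`; the bound `t` on `r` is the odd part of the totient of that product. -/
theorem card_le_of_fixed (h : IsAnisotropicAction β B Γ)
    (hΓ : Group.IsSolvable Γ) (hodd : Odd (Nat.card Γ)) {p k : ℕ} (hp : p.Prime)
    (hU : Nat.card U = p ^ k) {L : Finset ℕ} (w : ℕ → ℕ)
    (hw : ∀ ℓ : ℕ, ℓ.Prime → Odd ℓ → ℓ ≠ p → ∀ i < k, IsSquare (p ^ i) →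
      ℓ ∣ p ^ k - p ^ i → ℓ ∈ L ∧ p ^ i = w ℓ)
    (hnd : ∀ ℓ ∈ L, ¬ ℓ ^ 2 ∣ p ^ k + (ℓ ^ 2 - 1) * w ℓ) {t a : ℕ}
    (ht : (∏ ℓ ∈ L, ℓ).totient = 2 ^ a * t) (hL : ∏ ℓ ∈ L, ℓ ≠ 0) (ht0 : t ≠ 0) :
    Nat.card B ≤ (∏ ℓ ∈ L, ℓ) * t := by
  obtain ⟨n, r, hn, hsf, hr, hro, hcard⟩ := h.exists_card_eq_mul_dvd_totient_of_fixed hΓ hodd hp hU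
    (L := L) w (by
      intro ℓ hℓ hℓo hℓp c hc hcs hc1 hc2
      obtain ⟨i, hi, rfl⟩ := (Nat.dvd_prime_pow hp).1 hc
      have hik : i < k := lt_of_le_of_ne hi fun hh => hc1 (by rw [hh])
      exact hw ℓ hℓ hℓo hℓp i hik hcs
        ((Nat.modEq_iff_dvd' (Nat.pow_le_pow_right hp.pos hi)).1 hc2)) hnd
  have h1 := Nat.dvd_prod_of_squarefree hsf hn
  have h2 : r ∣ 2 ^ a * t := ht ▸ hr.trans (Nat.totient_dvd_of_dvd h1)
  have h3 : r ∣ t :=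
    (Nat.Coprime.pow_right a (Nat.coprime_two_right.2 hro)).dvd_of_dvd_mul_left h2
  rw [hcard]
  exact Nat.mul_le_mul (Nat.le_of_dvd (Nat.pos_of_ne_zero hL) h1)
    (Nat.le_of_dvd (Nat.pos_of_ne_zero ht0) h3)

theorem not_isSquare_of_sq_lt {n k : ℕ} (h1 : k * k < n) (h2 : n < (k + 1) * (k + 1)) :
    ¬ IsSquare n := by
  rintro ⟨m, rfl⟩
  have := Nat.mul_self_lt_mul_self_iff.1 h1
  have := Nat.mul_self_lt_mul_self_iff.1 h2
  omega

/-- The only odd prime dividing `5 ^ 2 - 1` is `3`, and an element of order `3` has no nontrivial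
fixed points. -/
theorem card_le_of_card_eq_25 (h : IsAnisotropicAction β B Γ)
    (hΓ : Group.IsSolvable Γ) (hodd : Odd (Nat.card Γ)) (hU : Nat.card U = 5 ^ 2) :
    Nat.card B ≤ 3 := by
  refine h.card_le_of_fixed hΓ hodd Nat.prime_five hU (L := {3}) (fun _ => 1) ?_ (by decide)
    (t := 1) (a := 1) (by decide) (by decide) (by decide)
  intro ℓ hℓ hodd hne i hi hs hd
  interval_cases i
  · have : ℓ ∣ 2 ^ 3 * 3 := hd
    rw [hℓ.dvd_mul] at this
    rcases this with h1 | h1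
    · rw [(Nat.prime_dvd_prime_iff_eq hℓ Nat.prime_two).1 (hℓ.dvd_of_dvd_pow h1)] at hodd
      exact absurd hodd (by decide)
    · rw [(Nat.prime_dvd_prime_iff_eq hℓ Nat.prime_three).1 h1]
      decide
  · exact absurd hs (not_isSquare_of_sq_lt (k := 2) (by norm_num) (by norm_num))

/-- The only odd prime dividing `7 ^ 2 - 1` is `3`, and an element of order `3` has no nontrivial
fixed points. -/
theorem card_le_of_card_eq_49 (h : IsAnisotropicAction β B Γ)
    (hΓ : Group.IsSolvable Γ) (hodd : Odd (Nat.card Γ)) (hU : Nat.card U = 7 ^ 2) :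
    Nat.card B ≤ 3 := by
  refine h.card_le_of_fixed hΓ hodd Nat.prime_seven hU (L := {3}) (fun _ => 1) ?_ (by decide)
    (t := 1) (a := 1) (by decide) (by decide) (by decide)
  intro ℓ hℓ hodd hne i hi hs hd
  interval_cases i
  · have : ℓ ∣ 2 ^ 4 * 3 := hd
    rw [hℓ.dvd_mul] at this
    rcases this with h1 | h1
    · rw [(Nat.prime_dvd_prime_iff_eq hℓ Nat.prime_two).1 (hℓ.dvd_of_dvd_pow h1)] at hodd
      exact absurd hodd (by decide)
    · rw [(Nat.prime_dvd_prime_iff_eq hℓ Nat.prime_three).1 h1]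
      decide
  · exact absurd hs (not_isSquare_of_sq_lt (k := 2) (by norm_num) (by norm_num))

/-- The possible numbers of fixed points are `1` and `9`, and the only prime other than `2` and `3`
dividing `81 - 1` or `81 - 9` is `5`. -/
theorem card_le_of_card_eq_81 (h : IsAnisotropicAction β B Γ)
    (hΓ : Group.IsSolvable Γ) (hodd : Odd (Nat.card Γ)) (hU : Nat.card U = 3 ^ 4) :
    Nat.card B ≤ 5 := by
  refine h.card_le_of_fixed hΓ hodd Nat.prime_three hU (L := {5}) (fun _ => 1) ?_ (by decide)
    (t := 1) (a := 2) (by decide) (by decide) (by decide)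
  intro ℓ hℓ hodd hne i hi hs hd
  have hℓ2 : ℓ ≠ 2 := by rintro rfl; exact absurd hodd (by decide)
  interval_cases i
  · have : ℓ ∣ 2 ^ 4 * 5 := hd
    rw [hℓ.dvd_mul] at this
    rcases this with h1 | h1
    · exact absurd ((Nat.prime_dvd_prime_iff_eq hℓ Nat.prime_two).1 (hℓ.dvd_of_dvd_pow h1)) hℓ2
    · rw [(Nat.prime_dvd_prime_iff_eq hℓ Nat.prime_five).1 h1]
      decide
  · exact absurd hs (not_isSquare_of_sq_lt (k := 1) (by norm_num) (by norm_num))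
  · have : ℓ ∣ 2 ^ 3 * 3 ^ 2 := hd
    rw [hℓ.dvd_mul] at this
    rcases this with h1 | h1
    · exact absurd ((Nat.prime_dvd_prime_iff_eq hℓ Nat.prime_two).1 (hℓ.dvd_of_dvd_pow h1)) hℓ2
    · exact absurd ((Nat.prime_dvd_prime_iff_eq hℓ Nat.prime_three).1 (hℓ.dvd_of_dvd_pow h1)) hne
  · exact absurd hs (not_isSquare_of_sq_lt (k := 5) (by norm_num) (by norm_num))

/-- The possible numbers of fixed points are `1`, `9` and `81`; the primes other than `2` and `3`
that divide `729 - 1`, `729 - 9` or `729 - 81` are `7` and `13`, with one fixed point, and `5`, with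
nine. The bound is `5 * 7 * 13 * 9`, where `9` is the odd part of `φ 455`. -/
theorem card_le_of_card_eq_729 (h : IsAnisotropicAction β B Γ)
    (hΓ : Group.IsSolvable Γ) (hodd : Odd (Nat.card Γ)) (hU : Nat.card U = 3 ^ 6) :
    Nat.card B ≤ 4095 := by
  have hp13 : Nat.Prime 13 := by norm_num
  have htot : Nat.totient 455 = 2 ^ 5 * 9 := by
    rw [show 455 = 5 * (7 * 13) from rfl, Nat.totient_mul (by norm_num),
      Nat.totient_mul (by norm_num), Nat.totient_prime Nat.prime_five,
      Nat.totient_prime Nat.prime_seven, Nat.totient_prime hp13]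
    norm_num
  refine h.card_le_of_fixed hΓ hodd Nat.prime_three hU (L := {5, 7, 13})
    (fun ℓ => if ℓ = 5 then 9 else 1) ?_ (by decide)
    (t := 9) (a := 5) htot (by decide) (by decide)
  intro ℓ hℓ hodd hne i hi hs hd
  have hℓ2 : ℓ ≠ 2 := by rintro rfl; exact absurd hodd (by decide)
  interval_cases i
  · have : ℓ ∣ 2 ^ 3 * (7 * 13) := hd
    rw [hℓ.dvd_mul, hℓ.dvd_mul] at this
    rcases this with h1 | h1 | h1
    · exact absurd ((Nat.prime_dvd_prime_iff_eq hℓ Nat.prime_two).1 (hℓ.dvd_of_dvd_pow h1)) hℓ2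
    · rw [(Nat.prime_dvd_prime_iff_eq hℓ Nat.prime_seven).1 h1]
      decide
    · rw [(Nat.prime_dvd_prime_iff_eq hℓ hp13).1 h1]
      decide
  · exact absurd hs (not_isSquare_of_sq_lt (k := 1) (by norm_num) (by norm_num))
  · have : ℓ ∣ 2 ^ 4 * (3 ^ 2 * 5) := hd
    rw [hℓ.dvd_mul, hℓ.dvd_mul] at this
    rcases this with h1 | h1 | h1
    · exact absurd ((Nat.prime_dvd_prime_iff_eq hℓ Nat.prime_two).1 (hℓ.dvd_of_dvd_pow h1)) hℓ2
    · exact absurd ((Nat.prime_dvd_prime_iff_eq hℓ Nat.prime_three).1 (hℓ.dvd_of_dvd_pow h1)) hne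
    · rw [(Nat.prime_dvd_prime_iff_eq hℓ Nat.prime_five).1 h1]
      decide
  · exact absurd hs (not_isSquare_of_sq_lt (k := 5) (by norm_num) (by norm_num))
  · have : ℓ ∣ 2 ^ 3 * 3 ^ 4 := hd
    rw [hℓ.dvd_mul] at this
    rcases this with h1 | h1
    · exact absurd ((Nat.prime_dvd_prime_iff_eq hℓ Nat.prime_two).1 (hℓ.dvd_of_dvd_pow h1)) hℓ2
    · exact absurd ((Nat.prime_dvd_prime_iff_eq hℓ Nat.prime_three).1 (hℓ.dvd_of_dvd_pow h1)) hne
  · exact absurd hs (not_isSquare_of_sq_lt (k := 15) (by norm_num) (by norm_num))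

end IsAnisotropicAction

/-! ### Maximal commutative normal subgroups and the layer above them -/

theorem commutatorElement_mem_iff_commute_mk {G : Type*} [Group G] {T : Subgroup G} [T.Normal]
    {x y : G} : ⁅x, y⁆ ∈ T ↔ Commute (x : G ⧸ T) (y : G ⧸ T) := by
  rw [← QuotientGroup.eq_one_iff, ← QuotientGroup.mk'_apply, map_commutatorElement,
    commutatorElement_eq_one_iff_mul_comm]
  exact Iff.rfl

/-- `T` contains every commutative normal subgroup of `G` that contains `T`, and is itself
commutative and normal. -/
structure IsMaximalCommutativeNormal {G : Type*} [Group G] (T : Subgroup G) : Prop where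
  normal : T.Normal
  comm : ∀ x ∈ T, ∀ y ∈ T, x * y = y * x
  le_of_le : ∀ N : Subgroup G, N.Normal → (∀ x ∈ N, ∀ y ∈ N, x * y = y * x) → T ≤ N → N ≤ T

theorem exists_isMaximalCommutativeNormal (G : Type*) [Group G] [Finite G] :
    ∃ T : Subgroup G, IsMaximalCommutativeNormal T := by
  let S : Set (Subgroup G) := {N | N.Normal ∧ ∀ x ∈ N, ∀ y ∈ N, x * y = y * x}
  have hS : S.Nonempty := ⟨⊥, inferInstance, fun x hx y hy => by
    rw [mem_bot.1 hx, mem_bot.1 hy]⟩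
  obtain ⟨T, ⟨h1, h2⟩, hmax⟩ := (Set.toFinite S).exists_maximal hS
  exact ⟨T, h1, h2, fun N hN hc hle => hmax ⟨hN, hc⟩ hle⟩

/-- `F / T` is abelian of exponent dividing the squarefree number `m`, where `T ≤ F ≤ C_G(T)` and
`F` is normal in `G`, and `F` is large enough to have a centralizer in `C_G(T)` that is contained
in `T`. -/
structure IsSelfCentralizingLayer {G : Type*} [Group G] (T F : Subgroup G) (m : ℕ) : Prop where
  normal : F.Normal
  le : T ≤ F
  le_centralizer : F ≤ centralizer (T : Set G)
  commutator_mem : ∀ x ∈ F, ∀ y ∈ F, ⁅x, y⁆ ∈ T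
  squarefree : Squarefree m
  pow_mem : ∀ x ∈ F, x ^ m ∈ T
  mem_of_commute : ∀ a ∈ centralizer (T : Set G), (∀ x ∈ F, x * a = a * x) → a ∈ T

/-- Let `m` be the product of the primes dividing `|G|`, and let `F` be maximal among the normal
subgroups between `T` and `C_G(T)` with `F / T` abelian of exponent dividing `m`. If `C_G(F)` were
larger than `T`, it would contain a normal subgroup `M > T` with `M / T` elementary abelian. Then
`F M` is again such a subgroup, so `M ≤ F ∩ C_G(F)` is commutative, against the choice of `T`. -/
theorem IsMaximalCommutativeNormal.exists_layer {G : Type*} [Group G] [Finite G]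
    (hG : Group.IsSolvable G) {T : Subgroup G} (hT : IsMaximalCommutativeNormal T) :
    ∃ F m, IsSelfCentralizingLayer T F m := by
  have := hT.normal
  have hsqf : Squarefree (∏ p ∈ (Nat.card G).primeFactors, p) := by
    refine Finset.squarefree_prod_of_pairwise_isCoprime (fun p hp q hq hne => ?_)
      fun p hp => (Nat.prime_of_mem_primeFactors hp).prime.squarefree
    exact Nat.coprime_iff_isRelPrime.1 ((Nat.coprime_primes (Nat.prime_of_mem_primeFactors hp)
      (Nat.prime_of_mem_primeFactors hq)).2 hne)
  generalize hm : ∏ p ∈ (Nat.card G).primeFactors, p = m at hsqf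
  let S : Set (Subgroup G) := {F | F.Normal ∧ T ≤ F ∧ F ≤ centralizer (T : Set G) ∧
    (∀ x ∈ F, ∀ y ∈ F, ⁅x, y⁆ ∈ T) ∧ ∀ x ∈ F, x ^ m ∈ T}
  have hTS : T ∈ S := by
    refine ⟨hT.normal, le_rfl, fun x hx => mem_centralizer_iff.2 fun y hy => hT.comm y hy x hx,
      fun x hx y hy => ?_, fun x hx => T.pow_mem hx _⟩
    rw [commutatorElement_eq_one_iff_mul_comm.2 (hT.comm x hx y hy)]
    exact T.one_mem
  obtain ⟨F, ⟨hFn, hTF, hFA, hFc, hFm⟩, hmax⟩ := (Set.toFinite S).exists_maximal ⟨T, hTS⟩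
  refine ⟨F, m, hFn, hTF, hFA, hFc, hsqf, hFm, fun a _ ha => ?_⟩
  by_contra haT
  have hTC : T ≤ centralizer (F : Set G) := fun t ht =>
    mem_centralizer_iff.2 fun x hx => (mem_centralizer_iff.1 (hFA hx) t ht).symm
  have hlt : T < centralizer (F : Set G) :=
    lt_of_le_of_ne hTC fun h => haT (h ▸ mem_centralizer_iff.2 ha)
  obtain ⟨p, M, hp, hMn, hTM, hMC, hMc, hMp⟩ :=
    exists_normal_elementary_abelian_between hG T (centralizer (F : Set G)) hlt
  have hMA : M ≤ centralizer (T : Set G) := hMC.trans (centralizer_le hTF)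
  obtain ⟨x₀, hx₀M, hx₀T⟩ := SetLike.not_le_iff_exists.1 hTM.not_ge
  have hpG : p ∣ Nat.card G := by
    have h1 : ((x₀ : G ⧸ T)) ^ p = 1 := by
      rw [← QuotientGroup.mk_pow, QuotientGroup.eq_one_iff]
      exact hMp x₀ hx₀M
    have h2 : orderOf (x₀ : G ⧸ T) = p := by
      rcases (Nat.dvd_prime hp).1 (orderOf_dvd_of_pow_eq_one h1) with h3 | h3
      · rw [orderOf_eq_one_iff, QuotientGroup.eq_one_iff] at h3
        exact absurd h3 hx₀T
      · exact h3
    rw [← h2]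
    exact (_root_.orderOf_dvd_natCard _).trans ((index_eq_card T) ▸ index_dvd_card T)
  have hpm : p ∣ m := hm ▸ Finset.dvd_prod_of_mem _
    (Nat.mem_primeFactors.2 ⟨hp, hpG, Nat.card_pos.ne'⟩)
  have hFM : ∀ f ∈ F, ∀ y ∈ M, Commute (f : G ⧸ T) (y : G ⧸ T) := fun f hf y hy => by
    have := mem_centralizer_iff.1 (hMC hy) f hf
    change (f : G ⧸ T) * y = y * f
    rw [← QuotientGroup.mk_mul, ← QuotientGroup.mk_mul, this]
  have hmem : F ⊔ M ∈ S := by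
    refine ⟨inferInstance, hTF.trans le_sup_left, sup_le hFA hMA, ?_, ?_⟩
    · intro x hx y hy
      obtain ⟨f, hf, a, ha, rfl⟩ := mem_sup_of_normal_right.1 hx
      obtain ⟨g, hg, b, hb, rfl⟩ := mem_sup_of_normal_right.1 hy
      rw [commutatorElement_mem_iff_commute_mk, QuotientGroup.mk_mul, QuotientGroup.mk_mul]
      refine Commute.mul_left (Commute.mul_right ?_ (hFM f hf b hb))
        (Commute.mul_right (hFM g hg a ha).symm ?_)
      · exact commutatorElement_mem_iff_commute_mk.1 (hFc f hf g hg)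
      · exact commutatorElement_mem_iff_commute_mk.1 (hMc a ha b hb)
    · intro x hx
      obtain ⟨f, hf, a, ha, rfl⟩ := mem_sup_of_normal_right.1 hx
      obtain ⟨c, rfl⟩ := hpm
      rw [← QuotientGroup.eq_one_iff, QuotientGroup.mk_pow, QuotientGroup.mk_mul,
        (hFM f hf a ha).mul_pow, ← QuotientGroup.mk_pow, ← QuotientGroup.mk_pow,
        (QuotientGroup.eq_one_iff _).2 (hFm f hf), one_mul, QuotientGroup.eq_one_iff, pow_mul]
      exact T.pow_mem (hMp a ha) c
  have hMF : M ≤ F := le_sup_right.trans (hmax hmem le_sup_left)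
  exact hTM.not_ge (hT.le_of_le M hMn
    (fun x hx y hy => mem_centralizer_iff.1 (hMC hy) x (hMF hx)) hTM.le)

/-- The action of `G` on the abelian group `U = F / T`, with the pairing induced by commutators
`F × F → T`. The radical of the pairing on a `G`-invariant subgroup of `U` lifts to a commutative
normal subgroup of `G`, so it is trivial by the maximality of `T`. -/
theorem IsSelfCentralizingLayer.exists_action.{u, v} {G : Type u} [Group G] [Finite G]
    {T F : Subgroup G} {m : ℕ} (hT : IsMaximalCommutativeNormal T)
    (hF : IsSelfCentralizingLayer T F m) {K : Type v} [Field K] (θ : T →* Kˣ)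
    (hθ : Function.Injective θ) :
    ∃ (U : Type u) (_ : CommGroup U) (_ : Finite U) (β : U →* U →* Kˣ) (φ : G →* MulAut U)
      (π : F →* U), Function.Surjective π ∧ π.ker = T.subgroupOf F ∧
      (∀ (g : G) (x y : F), (y : G) = g * x * g⁻¹ → φ g (π x) = π y) ∧
      IsAnisotropicAction β ((centralizer (T : Set G)).map φ) φ.range := by
  have hTn := hT.normal
  have hFn := hF.normal
  have hFT : ∀ x ∈ F, ∀ t ∈ T, x * t = t * x := fun x hx t ht =>
    (mem_centralizer_iff.1 (hF.le_centralizer hx) t ht).symm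
  let N : Subgroup F := T.subgroupOf F
  let U := F ⧸ N
  let _ : CommGroup U := { (inferInstance : Group (F ⧸ N)) with
    mul_comm := by
      intro a b
      obtain ⟨x, rfl⟩ := QuotientGroup.mk_surjective a
      obtain ⟨y, rfl⟩ := QuotientGroup.mk_surjective b
      exact commutatorElement_mem_iff_commute_mk.1
        (mem_subgroupOf.2 (hF.commutator_mem x x.2 y y.2)) }
  let π : F →* U := QuotientGroup.mk' N
  have hπ : Function.Surjective π := QuotientGroup.mk'_surjective N
  let γ : F →* F →* Kˣ := commPairing T F F θ hFT hFT hF.commutator_mem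
  have hγ : ∀ x y : F, γ x y = 1 ↔ (x : G) * y = y * x := by
    intro x y
    rw [show γ x y = θ ⟨⁅(x : G), (y : G)⁆, hF.commutator_mem x x.2 y y.2⟩ from rfl,
      ← map_one θ, hθ.eq_iff, Subtype.ext_iff]
    exact commutatorElement_eq_one_iff_mul_comm
  have hN2 : ∀ x : F, N ≤ (γ x).ker := fun x t ht =>
    MonoidHom.mem_ker.2 ((hγ x t).2 (hFT x x.2 t (mem_subgroupOf.1 ht)))
  let γ' : F →* U →* Kˣ := MonoidHom.mk' (fun x => QuotientGroup.lift N (γ x) (hN2 x)) (by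
    intro a b
    ext y
    exact congrArg Units.val (DFunLike.congr_fun (map_mul γ a b) y))
  have hN1 : N ≤ γ'.ker := by
    intro t ht
    rw [MonoidHom.mem_ker]
    ext y
    exact congrArg Units.val ((hγ t y).2 (hFT y y.2 t (mem_subgroupOf.1 ht)).symm)
  let β : U →* U →* Kˣ := QuotientGroup.lift N γ' hN1
  have hβ : ∀ x y : F, β (π x) (π y) = γ x y := fun x y => rfl
  have hconj : ∀ (g : G), N.map ((MulAut.conjNormal g : MulAut F) : F →* F) = N := by
    have hle : ∀ g : G, N.map ((MulAut.conjNormal g : MulAut F) : F →* F) ≤ N := by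
      rintro g _ ⟨x, hx, rfl⟩
      exact mem_subgroupOf.2 (hTn.conj_mem x (mem_subgroupOf.1 hx) g)
    intro g
    refine le_antisymm (hle g) fun x hx => ?_
    refine ⟨(MulAut.conjNormal g⁻¹ : MulAut F) x, hle g⁻¹ ⟨x, hx, rfl⟩, ?_⟩
    rw [map_inv]
    exact MulAut.apply_inv_self _ _ _
  let φ : G →* MulAut U := MonoidHom.mk'
    (fun g => QuotientGroup.congr N N (MulAut.conjNormal g) (hconj g)) (by
      intro a b
      ext u
      obtain ⟨y, rfl⟩ := hπ u
      change π (MulAut.conjNormal (a * b) y) = π (MulAut.conjNormal a (MulAut.conjNormal b y))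
      rw [map_mul]; rfl)
  have hφ : ∀ (g : G) (x : F), φ g (π x) = π (MulAut.conjNormal g x) := fun g x => rfl
  refine ⟨U, inferInstance, inferInstance, β, φ, π, hπ, QuotientGroup.ker_mk' N, ?_, ?_⟩
  · intro g x y hy
    rw [hφ]
    congr 1
    exact Subtype.ext hy.symm
  · have hinv : ∀ (g : G) (x y : F), γ x y = 1 → γ (MulAut.conjNormal g x)
        (MulAut.conjNormal g y) = 1 := by
      intro g x y h
      rw [hγ] at h ⊢
      change g * x * g⁻¹ * (g * y * g⁻¹) = g * y * g⁻¹ * (g * x * g⁻¹)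
      calc g * x * g⁻¹ * (g * y * g⁻¹) = g * (x * y) * g⁻¹ := by group
        _ = g * (y * x) * g⁻¹ := by rw [h]
        _ = _ := by group
    refine ⟨?_, ?_, ?_, map_le_range φ _, ?_, ?_⟩
    · intro u
      obtain ⟨x, rfl⟩ := hπ u
      rw [hβ, hγ]
    · rintro _ ⟨a, ha, rfl⟩ u v
      obtain ⟨x, rfl⟩ := hπ u
      obtain ⟨y, rfl⟩ := hπ v
      rw [hφ, hφ, hβ, hβ]
      change θ _ = θ _
      congr 1
      ext
      change ⁅a * x * a⁻¹, a * y * a⁻¹⁆ = ⁅(x : G), (y : G)⁆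
      have h1 := mem_centralizer_iff.1 ha _ (hF.commutator_mem x x.2 y y.2)
      calc ⁅a * x * a⁻¹, a * y * a⁻¹⁆ = a * ⁅(x : G), (y : G)⁆ * a⁻¹ := by
            simp only [commutatorElement_def]; group
        _ = ⁅(x : G), (y : G)⁆ := by rw [← h1, mul_inv_cancel_right]
    · rintro _ ⟨g, rfl⟩ u v h
      obtain ⟨x, rfl⟩ := hπ u
      obtain ⟨y, rfl⟩ := hπ v
      exact hinv g x y h
    · rintro _ ⟨g, rfl⟩ _ ⟨a, ha, rfl⟩
      have : (centralizer (T : Set G)).Normal := inferInstance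
      exact ⟨g * a * g⁻¹, this.conj_mem a ha g, by simp⟩
    · intro W hW w hw hperp
      -- the elements of `W` orthogonal to `W` lift to a commutative normal subgroup of `G`
      let R : Subgroup F := (W ⊓ pairingPerp β W).comap π
      have hRn : (R.map F.subtype).Normal := by
        refine ⟨?_⟩
        rintro _ ⟨x, ⟨hx1, hx2⟩, rfl⟩ g
        refine ⟨MulAut.conjNormal g x, ⟨hW _ ⟨g, rfl⟩ _ hx1, mem_pairingPerp.2 fun v hv => ?_⟩, rfl⟩
        have hv' := hW _ ⟨g⁻¹, rfl⟩ v hv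
        have h1 := mem_pairingPerp.1 hx2 _ hv'
        obtain ⟨y, rfl⟩ := hπ v
        have h2 := hinv g (MulAut.conjNormal g⁻¹ y) x h1
        have h3 : MulAut.conjNormal g (MulAut.conjNormal g⁻¹ y) = y := by
          rw [map_inv]
          exact MulAut.apply_inv_self _ _ _
        rw [h3] at h2
        exact h2
      have hRc : ∀ x ∈ R.map F.subtype, ∀ y ∈ R.map F.subtype, x * y = y * x := by
        rintro _ ⟨x, ⟨hx1, hx2⟩, rfl⟩ _ ⟨y, ⟨hy1, hy2⟩, rfl⟩
        exact (hγ x y).1 (mem_pairingPerp.1 hy2 (π x) hx1)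
      have hTR : T ≤ R.map F.subtype := by
        intro t ht
        refine ⟨⟨t, hF.le ht⟩, ?_, rfl⟩
        have : π ⟨t, hF.le ht⟩ = 1 := (QuotientGroup.eq_one_iff _).2 (mem_subgroupOf.2 ht)
        rw [SetLike.mem_coe, mem_comap, this]
        exact one_mem _
      obtain ⟨x, rfl⟩ := hπ w
      refine (QuotientGroup.eq_one_iff _).2 (mem_subgroupOf.2 (hT.le_of_le _ hRn hRc hTR
        ⟨x, ⟨hw, mem_pairingPerp.2 fun v hv => ?_⟩, rfl⟩))
      obtain ⟨y, rfl⟩ := hπ v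
      have h1 := (hγ x y).1 (hperp _ hv)
      exact (hγ y x).2 h1.symm

/-! ### Bounds for the index of `T` in its centralizer -/

theorem commutatorElement_pow_right {G : Type*} [Group G] {x y : G} (h : Commute y ⁅x, y⁆)
    (i : ℕ) : ⁅x, y ^ i⁆ = ⁅x, y⁆ ^ i := by
  induction i with
  | zero => simp
  | succ i ih =>
    have h1 : ⁅x, y ^ (i + 1)⁆ = ⁅x, y⁆ * (y * ⁅x, y ^ i⁆ * y⁻¹) := by
      simp only [commutatorElement_def, pow_succ']; group
    rw [h1, ih, (h.pow_right i).eq, mul_inv_cancel_right, ← pow_succ']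

theorem commutatorElement_pow_left {G : Type*} [Group G] {x y : G} (h : Commute x ⁅x, y⁆)
    (i : ℕ) : ⁅x ^ i, y⁆ = ⁅x, y⁆ ^ i := by
  induction i with
  | zero => simp
  | succ i ih =>
    have h1 : ⁅x ^ (i + 1), y⁆ = x * ⁅x ^ i, y⁆ * x⁻¹ * ⁅x, y⁆ := by
      simp only [commutatorElement_def, pow_succ']; group
    rw [h1, ih, (h.pow_right i).eq, mul_inv_cancel_right, ← pow_succ]

namespace IsSelfCentralizingLayer

variable {G : Type*} [Group G] {T F : Subgroup G} {m : ℕ}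

theorem orderOf_commutatorElement_dvd [Finite G] (hF : IsSelfCentralizingLayer T F m)
    (hT : IsMaximalCommutativeNormal T) {x y : G} (hx : x ∈ centralizer (T : Set G)) (hy : y ∈ F)
    (hxy : ⁅x, y⁆ ∈ T) : orderOf ⁅x, y⁆ ∣ T.relIndex F := by
  have := hT.normal
  apply orderOf_dvd_of_pow_eq_one
  rw [← commutatorElement_pow_right
    (mem_centralizer_iff.1 (hF.le_centralizer hy) _ hxy).symm,
    commutatorElement_eq_one_iff_mul_comm]
  have h1 : y ^ T.relIndex F ∈ T := (T.subgroupOf F).pow_index_mem ⟨y, hy⟩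
  exact (mem_centralizer_iff.1 hx _ h1).symm

theorem exists_commutatorElement_ne_one (hF : IsSelfCentralizingLayer T F m) {x : G}
    (hx : x ∈ centralizer (T : Set G)) (hxT : x ∉ T) : ∃ y ∈ F, ⁅x, y⁆ ≠ 1 := by
  by_contra! h
  exact hxT (hF.mem_of_commute x hx fun y hy =>
    (commutatorElement_eq_one_iff_mul_comm.1 (h y hy)).symm)

/-- An element of order `p` modulo `T` has a nontrivial commutator with some element of `F`, and
this commutator is an element of `T` of order `p`. -/
theorem prime_dvd_card [Finite G] (hF : IsSelfCentralizingLayer T F m)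
    (hT : IsMaximalCommutativeNormal T) {p : ℕ} (hp : p.Prime) (hd : p ∣ T.relIndex F) :
    p ∣ Nat.card T := by
  have := hT.normal
  have := Fact.mk hp
  rw [relIndex, index_eq_card] at hd
  obtain ⟨u, hu⟩ := exists_prime_orderOf_dvd_card' p hd
  obtain ⟨x, rfl⟩ := QuotientGroup.mk_surjective u
  have hxp : (x : G) ^ p ∈ T := by
    have h1 : (x : F ⧸ T.subgroupOf F) ^ p = 1 := by rw [← hu, pow_orderOf_eq_one]
    rw [← QuotientGroup.mk_pow, QuotientGroup.eq_one_iff] at h1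
    exact h1
  have hxT : (x : G) ∉ T := by
    intro h
    rw [(QuotientGroup.eq_one_iff x).2 (mem_subgroupOf.2 h), orderOf_one] at hu
    exact hp.one_lt.ne hu
  obtain ⟨y, hy, hxy⟩ := hF.exists_commutatorElement_ne_one (hF.le_centralizer x.2) hxT
  have hz := hF.commutator_mem x x.2 y hy
  have h1 : ⁅(x : G), y⁆ ^ p = 1 := by
    rw [← commutatorElement_pow_left (mem_centralizer_iff.1 (hF.le_centralizer x.2) _ hz).symm,
      commutatorElement_eq_one_iff_mul_comm]
    exact mem_centralizer_iff.1 (hF.le_centralizer hy) _ hxp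
  have h2 : orderOf ⁅(x : G), y⁆ = p := by
    rcases (Nat.dvd_prime hp).1 (orderOf_dvd_of_pow_eq_one h1) with h3 | h3
    · exact absurd (orderOf_eq_one_iff.1 h3) hxy
    · exact h3
  rw [← h2]
  exact Subgroup.orderOf_dvd_natCard T hz

/-- Elements of `C_G(T)` acting trivially on `F / T` induce characters `F / T → T` via
commutators, and these characters determine them modulo `T`. -/
theorem relIndex_le_of_commutator_mem [Finite G] (hF : IsSelfCentralizingLayer T F m)
    {K : Type*} [Field K] (θ : T →* Kˣ) (hθ : Function.Injective θ) {D : Subgroup G}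
    (hD : D ≤ centralizer (T : Set G)) (hDF : ∀ x ∈ D, ∀ y ∈ F, ⁅x, y⁆ ∈ T) :
    T.relIndex D ≤ T.relIndex F := by
  have hcen : ∀ X ≤ centralizer (T : Set G), ∀ x ∈ X, ∀ t ∈ T, x * t = t * x :=
    fun X hX x hx t ht => (mem_centralizer_iff.1 (hX hx) t ht).symm
  let γ : D →* F →* Kˣ := commPairing T D F θ (hcen D hD) (hcen F hF.le_centralizer) hDF
  have hγ : ∀ (x : D) (y : F), γ x y = 1 ↔ (x : G) * y = y * x := by
    intro x y
    rw [show γ x y = θ ⟨⁅(x : G), (y : G)⁆, hDF x x.2 y y.2⟩ from rfl,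
      ← map_one θ, hθ.eq_iff, Subtype.ext_iff]
    exact commutatorElement_eq_one_iff_mul_comm
  have h1 : γ.ker ≤ T.subgroupOf D := by
    intro x hx
    refine mem_subgroupOf.2 (hF.mem_of_commute x (hD x.2) fun y hy => ?_)
    exact ((hγ x ⟨y, hy⟩).1 (DFunLike.congr_fun (MonoidHom.mem_ker.1 hx) ⟨y, hy⟩)).symm
  have h2 : T.subgroupOf F ≤ γ.flip.ker := by
    intro y hy
    rw [MonoidHom.mem_ker]
    ext x
    exact congrArg Units.val ((hγ x y).2 (hcen D hD x x.2 y (mem_subgroupOf.1 hy)))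
  calc T.relIndex D ≤ γ.ker.index := index_antitone h1
    _ = γ.flip.ker.index := index_ker_eq_index_ker_flip γ
    _ ≤ T.relIndex F := index_antitone h2

/-- The bounds on `|C_G(T) : T|` in terms of `e`, where `|F : T| = e ^ 2`. They come from
`|C_G(T) : T| ≤ |U| |B|`, where `U = F / T` and `B` is the group that `C_G(T)` induces on `U`. -/
theorem exists_relIndex_le [Finite G] (hF : IsSelfCentralizingLayer T F m)
    (hT : IsMaximalCommutativeNormal T) (hG : Group.IsSolvable G) (hodd : Odd (Nat.card G))
    {K : Type*} [Field K] (θ : T →* Kˣ) (hθ : Function.Injective θ) :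
    ∃ e, T.relIndex F = e * e ∧ e ≠ 3 ∧
      T.relIndex (centralizer (T : Set G)) ≤
        ∏ p ∈ e.primeFactors, p ^ (e.factorization p * (2 * e.factorization p + 3)) ∧
      (e = 5 → T.relIndex (centralizer (T : Set G)) ≤ 75) ∧
      (e = 7 → T.relIndex (centralizer (T : Set G)) ≤ 147) ∧
      (e = 9 → T.relIndex (centralizer (T : Set G)) ≤ 405) ∧
      (e = 27 → T.relIndex (centralizer (T : Set G)) ≤ 729 * 4095) := by
  obtain ⟨U, _, _, β, φ, π, hπ, hker, hφ, hact⟩ := hF.exists_action hT θ hθ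
  have hTn := hT.normal
  have hFn := hF.normal
  set A := centralizer (T : Set G) with hA
  have hcardU : Nat.card U = T.relIndex F := by
    rw [relIndex, ← hker, index_ker, MonoidHom.range_eq_top.2 hπ, card_top]
  have hTA : T ≤ A := fun x hx => mem_centralizer_iff.2 fun y hy => hT.comm y hy x hx
  -- the kernel of the action of `C_G(T)` on `U` has index at most `|U|` over `T`
  have hAle : T.relIndex A ≤ Nat.card U * Nat.card (A.map φ) := by
    have hTD : T ≤ φ.ker ⊓ A := by
      refine le_inf (fun t ht => ?_) hTA
      rw [MonoidHom.mem_ker]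
      ext u
      obtain ⟨x, rfl⟩ := hπ u
      refine hφ t x x ?_
      rw [mem_centralizer_iff.1 (hF.le_centralizer x.2) t ht, mul_inv_cancel_right]
    have h1 := relIndex_mul_relIndex T (φ.ker ⊓ A) A hTD inf_le_right
    rw [inf_relIndex_right, relIndex_ker] at h1
    rw [← h1, hcardU]
    refine Nat.mul_le_mul_right _ (hF.relIndex_le_of_commutator_mem θ hθ inf_le_right ?_)
    rintro x ⟨hx1, hx2⟩ y hy
    have h2 := hφ x ⟨y, hy⟩ ⟨x * y * x⁻¹, hFn.conj_mem y hy x⟩ rfl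
    rw [MonoidHom.mem_ker.1 hx1, MulAut.one_apply] at h2
    have h3 : (⟨x * y * x⁻¹, hFn.conj_mem y hy x⟩ : F) / ⟨y, hy⟩ ∈ π.ker := by
      rw [MonoidHom.mem_ker, map_div, ← h2, div_self']
    rw [hker, mem_subgroupOf] at h3
    rw [commutatorElement_def, ← div_eq_mul_inv]
    exact h3
  obtain ⟨e, he⟩ := hact.isSquare_card
  have he0 : e ≠ 0 := by
    rintro rfl
    exact Nat.card_pos.ne' he
  have hUm : ∀ u : U, u ^ m = 1 := by
    intro u
    obtain ⟨x, rfl⟩ := hπ u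
    rw [← map_pow, ← MonoidHom.mem_ker, hker, mem_subgroupOf]
    exact hF.pow_mem x x.2
  have hΓodd : Odd (Nat.card φ.range) := hodd.of_dvd_nat (card_range_dvd φ)
  have hΓsol : Group.IsSolvable φ.range := by
    have := hG
    exact Group.isSolvable_of_surjective φ.rangeRestrict_surjective
  refine ⟨e, hcardU ▸ he, ?_, ?_, ?_, ?_, ?_, ?_⟩
  · rintro rfl
    exact hact.card_ne_nine hΓodd he
  · have h1 := hact.card_le_prod hF.squarefree hUm
    rw [he, Nat.primeFactors_mul he0 he0, Finset.union_self] at h1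
    refine hAle.trans ((Nat.mul_le_mul_left _ h1).trans (le_of_eq ?_))
    rw [he]
    have h2 : e * e = ∏ p ∈ e.primeFactors, p ^ (2 * e.factorization p) := by
      conv_lhs => rw [← Nat.prod_factorization_pow_eq_self he0]
      rw [Finsupp.prod, Nat.support_factorization, ← Finset.prod_mul_distrib]
      exact Finset.prod_congr rfl fun p _ => by rw [← pow_add, two_mul]
    conv_lhs => enter [1]; rw [h2]
    rw [← Finset.prod_mul_distrib]
    refine Finset.prod_congr rfl fun p _ => ?_
    rw [Nat.factorization_mul he0 he0, Finsupp.add_apply, ← pow_add]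
    congr 1
    generalize e.factorization p = n
    have : (n + n) * (n + n + 1) = n * (2 * n + 1) * 2 := by ring
    rw [this, Nat.mul_div_cancel _ (by norm_num)]
    ring
  · rintro rfl
    have h1 := hact.card_le_of_card_eq_25 hΓsol hΓodd he
    exact hAle.trans (he ▸ Nat.mul_le_mul_left _ h1)
  · rintro rfl
    have h1 := hact.card_le_of_card_eq_49 hΓsol hΓodd he
    exact hAle.trans (he ▸ Nat.mul_le_mul_left _ h1)
  · rintro rfl
    have h1 := hact.card_le_of_card_eq_81 hΓsol hΓodd he
    exact hAle.trans (he ▸ Nat.mul_le_mul_left _ h1)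
  · rintro rfl
    have h1 := hact.card_le_of_card_eq_729 hΓsol hΓodd he
    exact hAle.trans (he ▸ Nat.mul_le_mul_left _ h1)

end IsSelfCentralizingLayer

/-! ### Numerical estimates -/

theorem mul_two_mul_add_three_le_pow {n : ℕ} (hn : 5 ≤ n) : n * (2 * n + 3) ≤ 3 ^ (n - 1) := by
  induction n, hn using Nat.le_induction with
  | base => norm_num
  | succ n hn ih =>
    obtain ⟨k, rfl⟩ : ∃ k, n = k + 1 := ⟨n - 1, by omega⟩
    simp only [Nat.add_sub_cancel] at ih ⊢
    rw [pow_succ]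
    nlinarith

theorem mul_two_mul_add_three_le_five_mul {n : ℕ} (hn : 1 ≤ n) :
    n * (2 * n + 3) ≤ 5 * 3 ^ (n - 1) := by
  by_cases h : 5 ≤ n
  · exact (mul_two_mul_add_three_le_pow h).trans (Nat.le_mul_of_pos_left _ (by norm_num))
  · have : n ≤ 4 := by omega
    interval_cases n <;> norm_num

theorem five_mul_mul_two_mul_add_three_le {n : ℕ} (hn : 3 ≤ n) :
    5 * (n * (2 * n + 3)) ≤ 2 * 5 ^ n := by
  induction n, hn using Nat.le_induction with
  | base => norm_num
  | succ n hn ih =>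
    rw [pow_succ]
    nlinarith

theorem five_mul_mul_two_mul_add_three_le_seven {n : ℕ} (hn : 2 ≤ n) :
    5 * (n * (2 * n + 3)) ≤ 2 * 7 ^ n := by
  induction n, hn using Nat.le_induction with
  | base => norm_num
  | succ n hn ih =>
    rw [pow_succ]
    nlinarith

theorem mul_two_mul_add_three_le_five_pow {n : ℕ} (hn : 1 ≤ n) : n * (2 * n + 3) ≤ 5 ^ n := by
  by_cases h : 3 ≤ n
  · have := five_mul_mul_two_mul_add_three_le h
    omega
  · have : n ≤ 2 := by omega
    interval_cases n <;> norm_num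

/-- A lower bound for the codimension of the eigenspaces of an element of `C_G(T)` outside `T`: a
third of `e` if `3` divides `e`, and otherwise two fifths of `e`, rounded up. -/
def codimBound (e : ℕ) : ℕ := if 3 ∣ e then e / 3 else (2 * e + 4) / 5

/-- Outside of a short list of exceptions, the exponent of `p` in the generic bound on
`|C_G(T) : T|` is at most `codimBound e`. -/
theorem mul_le_codimBound {e p : ℕ} (he : Odd e) (hp : p.Prime) (hpe : p ∣ e)
    (hne : e ∉ ({3, 5, 7, 9, 25, 27, 81} : Finset ℕ)) :
    e.factorization p * (2 * e.factorization p + 3) ≤ codimBound e := by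
  have he0 : e ≠ 0 := by rintro rfl; exact absurd he (by decide)
  obtain ⟨k, hk⟩ := Nat.ordProj_dvd e p
  have hn : 1 ≤ e.factorization p := (hp.dvd_iff_one_le_factorization he0).1 hpe
  have hkp : ¬ p ∣ k := by
    intro hd
    have := Nat.not_dvd_ordCompl hp he0
    rw [Nat.div_eq_of_eq_mul_right (Nat.pow_pos hp.pos) hk] at this
    exact this hd
  generalize e.factorization p = n at hk hn ⊢
  have hko : Odd k := he.of_dvd_nat (hk ▸ Dvd.intro_left _ rfl)
  have hpo : Odd p := he.of_dvd_nat hpe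
  have hp3 : 3 ≤ p := by
    have := hp.two_le
    rcases this.eq_or_lt with h | h
    · rw [← h] at hpo; exact absurd hpo (by decide)
    · exact h
  have hp4 : p ≠ 4 := by rintro rfl; exact absurd hpo (by decide)
  have hk2 : k ≠ 2 := by rintro rfl; exact absurd hko (by decide)
  have hk4 : k ≠ 4 := by rintro rfl; exact absurd hko (by decide)
  have hk0 : k ≠ 0 := by rintro rfl; exact absurd hko (by decide)
  simp only [Finset.mem_insert, Finset.mem_singleton, not_or] at hne
  by_cases h3 : p = 3
  · subst h3
    obtain ⟨j, rfl⟩ : ∃ j, n = j + 1 := ⟨n - 1, by omega⟩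
    have hc : codimBound e = 3 ^ j * k := by
      rw [codimBound, if_pos hpe, hk, pow_succ, mul_right_comm, Nat.mul_div_cancel _ (by norm_num)]
    rw [hc]
    by_cases hk1 : k = 1
    · subst hk1
      rw [mul_one]
      refine mul_two_mul_add_three_le_pow ?_
      by_contra hlt
      have : j ≤ 3 := by omega
      interval_cases j <;> simp_all
    · have h5 : 5 ≤ k := by
        have : k ≠ 3 := by rintro rfl; exact hkp dvd_rfl
        omega
      refine (mul_two_mul_add_three_le_five_mul (by omega : 1 ≤ j + 1)).trans ?_
      rw [Nat.add_sub_cancel, mul_comm]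
      exact Nat.mul_le_mul_left _ h5
  · have hp5 : 5 ≤ p := by omega
    by_cases hk1 : k = 1
    · subst hk1
      rw [mul_one] at hk
      have h3e : ¬ 3 ∣ e := by
        intro hd
        rw [hk] at hd
        exact h3 ((Nat.prime_dvd_prime_iff_eq Nat.prime_three hp).1
          (Nat.prime_three.dvd_of_dvd_pow hd)).symm
      rw [codimBound, if_neg h3e, Nat.le_div_iff_mul_le (by norm_num), mul_comm]
      by_cases h5 : p = 5
      · subst h5
        have hn3 : 3 ≤ n := by
          by_contra hlt
          have : n ≤ 2 := by omega
          interval_cases n <;> simp_all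
        have := five_mul_mul_two_mul_add_three_le hn3
        omega
      · have hp7 : 7 ≤ p := by
          have : p ≠ 6 := by rintro rfl; exact absurd hpo (by decide)
          omega
        by_cases hn1 : n = 1
        · subst hn1
          rw [pow_one] at hk
          have h8 : p ≠ 8 := by rintro rfl; exact absurd hpo (by decide)
          have h9 : p ≠ 9 := by rintro rfl; exact absurd hp (by decide)
          have h10 : p ≠ 10 := by rintro rfl; exact absurd hpo (by decide)
          omega
        · have h1 := five_mul_mul_two_mul_add_three_le_seven (by omega : 2 ≤ n)
          have h2 := Nat.pow_le_pow_left hp7 n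
          omega
    · have hk3 : 3 ≤ k := by omega
      have h1 := mul_two_mul_add_three_le_five_pow hn
      have h2 := Nat.pow_le_pow_left hp5 n
      have h4 : 3 * p ^ n ≤ e := by
        rw [hk, mul_comm]
        exact Nat.mul_le_mul_left _ hk3
      rw [codimBound]
      split_ifs <;> omega

/-- Here `M` is `|C_G(T) : T|`, `τ` is `|T|` and `q` is the order of the field. Generically
`M ≤ (rad e) ^ codimBound e ≤ τ ^ codimBound e`; for `e` in the list of exceptions the two sides are
compared numerically, with `q ≥ 2 p + 1` for a prime divisor `p` of `e`. -/
theorem three_mul_sub_one_lt {e M q τ : ℕ} (he : Odd e) (he3 : e ≠ 3) (hτ0 : τ ≠ 0)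
    (hτ : ∀ p : ℕ, p.Prime → p ∣ e → p ∣ τ) (hq : 2 * τ + 1 ≤ q)
    (hM : M ≤ ∏ p ∈ e.primeFactors, p ^ (e.factorization p * (2 * e.factorization p + 3)))
    (h5 : e = 5 → M ≤ 75) (h7 : e = 7 → M ≤ 147) (h9 : e = 9 → M ≤ 405)
    (h27 : e = 27 → M ≤ 729 * 4095) :
    3 * (M - 1) < 4 * q ^ codimBound e := by
  have hpτ : ∀ p : ℕ, p.Prime → p ∣ e → 2 * p + 1 ≤ q := fun p hp hd => by
    have := Nat.le_of_dvd (Nat.pos_of_ne_zero hτ0) (hτ p hp hd)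
    omega
  by_cases hmem : e ∈ ({3, 5, 7, 9, 25, 27, 81} : Finset ℕ)
  · simp only [Finset.mem_insert, Finset.mem_singleton] at hmem
    rcases hmem with rfl | rfl | rfl | rfl | rfl | rfl | rfl
    · exact absurd rfl he3
    · have h1 := h5 rfl
      have h2 := Nat.pow_le_pow_left (hpτ 5 Nat.prime_five (by norm_num)) 2
      rw [show codimBound 5 = 2 from rfl]
      omega
    · have h1 := h7 rfl
      have h2 := Nat.pow_le_pow_left (hpτ 7 Nat.prime_seven (by norm_num)) 3
      rw [show codimBound 7 = 3 from rfl]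
      omega
    · have h1 := h9 rfl
      have h2 := Nat.pow_le_pow_left (hpτ 3 Nat.prime_three (by norm_num)) 3
      rw [show codimBound 9 = 3 from rfl]
      omega
    · have h2 := Nat.pow_le_pow_left (hpτ 5 Nat.prime_five (by norm_num)) 10
      rw [show 25 = 5 ^ 2 from rfl, Nat.primeFactors_prime_pow two_ne_zero Nat.prime_five,
        Finset.prod_singleton, Nat.prime_five.factorization_pow, Finsupp.single_eq_same] at hM
      rw [show codimBound 25 = 10 from rfl]
      omega
    · have h1 := h27 rfl
      have h2 := Nat.pow_le_pow_left (hpτ 3 Nat.prime_three (by norm_num)) 9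
      rw [show codimBound 27 = 9 from rfl]
      omega
    · have h2 := Nat.pow_le_pow_left (hpτ 3 Nat.prime_three (by norm_num)) 27
      rw [show 81 = 3 ^ 4 from rfl, Nat.primeFactors_prime_pow (by norm_num) Nat.prime_three,
        Finset.prod_singleton, Nat.prime_three.factorization_pow, Finsupp.single_eq_same] at hM
      rw [show codimBound 81 = 27 from rfl]
      omega
  · have h1 : M ≤ q ^ codimBound e := by
      calc M ≤ ∏ p ∈ e.primeFactors, p ^ codimBound e := by
            refine hM.trans (Finset.prod_le_prod (fun _ _ => Nat.zero_le _) fun p hp => ?_)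
            have hp' := Nat.prime_of_mem_primeFactors hp
            exact Nat.pow_le_pow_right hp'.pos
              (mul_le_codimBound he hp' (Nat.dvd_of_mem_primeFactors hp) hmem)
        _ = (∏ p ∈ e.primeFactors, p) ^ codimBound e := Finset.prod_pow _ _ _
        _ ≤ q ^ codimBound e := by
            refine Nat.pow_le_pow_left ?_ _
            have hd : ∏ p ∈ e.primeFactors, p ∣ τ :=
              Finset.prod_primes_dvd τ (fun p hp => (Nat.prime_of_mem_primeFactors hp).prime)
                fun p hp => hτ p (Nat.prime_of_mem_primeFactors hp) (Nat.dvd_of_mem_primeFactors hp)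
            have := Nat.le_of_dvd (Nat.pos_of_ne_zero hτ0) hd
            omega
    have h2 : 0 < q ^ codimBound e := Nat.pow_pos (by omega)
    omega

/-- The final estimate: `d` is the dimension of the space, `a` bounds the dimensions of the
eigenspaces and `b` bounds all but one of them. -/
theorem sub_one_mul_lt_two_mul_pow {e M q τ d a b : ℕ} (he : Odd e) (he5 : 5 ≤ e)
    (hq : 2 * τ + 1 ≤ q) (hM : 3 * (M - 1) < 4 * q ^ codimBound e) (hd : e ≤ d)
    (ha : if 3 ∣ e then 3 * a ≤ 2 * d else 5 * a ≤ 3 * d) (hb : 2 * b ≤ d) :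
    (M - 1) * (q ^ a + τ * q ^ b) < 2 * q ^ d := by
  obtain ⟨i, rfl⟩ := he
  have hac : a + codimBound (2 * i + 1) ≤ d := by
    rw [codimBound]
    split_ifs at ha ⊢ <;> omega
  have hbc : b + codimBound (2 * i + 1) + 1 ≤ d := by
    rw [codimBound]
    split_ifs at ha ⊢ <;> omega
  have hq0 : 0 < q := by omega
  set c := codimBound (2 * i + 1)
  have h1 : q ^ a ≤ q ^ (d - c) := Nat.pow_le_pow_right hq0 (by omega)
  have h2 : 2 * (τ * q ^ b) ≤ q ^ (d - c) := by
    calc 2 * (τ * q ^ b) = (2 * τ) * q ^ b := by ring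
      _ ≤ q * q ^ b := Nat.mul_le_mul_right _ (by omega)
      _ = q ^ (b + 1) := by rw [pow_succ']
      _ ≤ q ^ (d - c) := Nat.pow_le_pow_right hq0 (by omega)
  have h3 : q ^ d = q ^ c * q ^ (d - c) := by rw [← pow_add]; congr 1; omega
  have h4 : 0 < q ^ (d - c) := Nat.pow_pos hq0
  have h5 : 2 * (q ^ a + τ * q ^ b) ≤ 3 * q ^ (d - c) := by omega
  have h6 : (M - 1) * (2 * (q ^ a + τ * q ^ b)) ≤ (M - 1) * (3 * q ^ (d - c)) :=
    Nat.mul_le_mul_left _ h5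
  have h7 : 3 * (M - 1) * q ^ (d - c) < 4 * q ^ c * q ^ (d - c) :=
    Nat.mul_lt_mul_of_pos_right hM h4
  rw [h3]
  nlinarith

/-! ### Eigenspaces of elements acting over scalars -/

theorem sum_finrank_le_of_iSupIndep {K V ι : Type*} [Field K] [AddCommGroup V] [Module K V]
    [FiniteDimensional K V] [Fintype ι] (W : ι → Submodule K V) (hW : iSupIndep W) :
    ∑ i, Module.finrank K (W i) ≤ Module.finrank K V := by
  classical
  rw [← Module.finrank_directSum]
  exact LinearMap.finrank_le_finrank_of_injective (f := DirectSum.coeLinearMap W)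
    hW.dfinsupp_lsum_injective

section ScalarAction

variable {G K V : Type*} [Group G] {T F : Subgroup G} [Field K] [AddCommGroup V] [Module K V]

/-- The group `C_G(T)` acts linearly on `V`, and `T` acts through the scalars `θ`. -/
structure IsScalarAction (T : Subgroup G) (L : centralizer (T : Set G) →* Module.End K V)
    (θ : T →* Kˣ) : Prop where
  comm : T ≤ centralizer (T : Set G)
  scalar : ∀ (t : T) (v : V), L ⟨t, comm t.2⟩ v = (θ t : K) • v
  injective : Function.Injective θ

variable {L : centralizer (T : Set G) →* Module.End K V} {θ : T →* Kˣ}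

theorem IsScalarAction.apply_eq_smul (h : IsScalarAction T L θ) {a : centralizer (T : Set G)}
    (ha : (a : G) ∈ T) (v : V) : L a v = (θ ⟨a, ha⟩ : K) • v := h.scalar ⟨a, ha⟩ v

theorem apply_inv_apply_self (a : centralizer (T : Set G)) (v : V) : L a⁻¹ (L a v) = v := by
  rw [← Module.End.mul_apply, ← map_mul, inv_mul_cancel, map_one, Module.End.one_apply]

theorem apply_self_inv_apply (a : centralizer (T : Set G)) (v : V) : L a (L a⁻¹ v) = v := by
  rw [← Module.End.mul_apply, ← map_mul, mul_inv_cancel, map_one, Module.End.one_apply]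

theorem apply_injective (a : centralizer (T : Set G)) : Function.Injective (L a) :=
  Function.LeftInverse.injective (apply_inv_apply_self a)

/-- If the commutator of `a` and `y` is the scalar `z`, then `y` shifts the eigenvalues of `a`
by `z`. -/
theorem IsScalarAction.apply_mem_eigenspace (h : IsScalarAction T L θ)
    {a y : centralizer (T : Set G)} (hz : ⁅(a : G), (y : G)⁆ ∈ T) {c : K} {v : V}
    (hv : v ∈ Module.End.eigenspace (L a) c) :
    L y v ∈ Module.End.eigenspace (L a) ((θ ⟨_, hz⟩ : K) * c) := by
  rw [Module.End.mem_eigenspace_iff] at hv ⊢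
  have h1 : a * y = ⁅a, y⁆ * (y * a) := by rw [commutatorElement_def]; group
  have h2 : L a (L y v) = L ⁅a, y⁆ (L y (L a v)) := by
    rw [← Module.End.mul_apply, ← map_mul, h1, map_mul, map_mul]; rfl
  have hz' : ((⁅a, y⁆ : centralizer (T : Set G)) : G) ∈ T := hz
  rw [h2, h.apply_eq_smul hz', hv, map_smul, smul_smul]
  rfl

/-- The powers of `y` carry an eigenspace of `a` into eigenspaces for as many distinct eigenvalues
as the order of the commutator of `a` and `y`, and eigenspaces are independent. -/
theorem IsScalarAction.orderOf_mul_finrank_eigenspace_le [Finite G] [FiniteDimensional K V]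
    (h : IsScalarAction T L θ) {a y : centralizer (T : Set G)} (hz : ⁅(a : G), (y : G)⁆ ∈ T)
    (c : K) : orderOf ⁅(a : G), (y : G)⁆ * Module.finrank K (Module.End.eigenspace (L a) c) ≤
      Module.finrank K V := by
  set z : T := ⟨_, hz⟩ with hzdef
  have ho : orderOf ⁅(a : G), (y : G)⁆ = orderOf (θ z) := by
    rw [orderOf_injective θ h.injective, ← orderOf_coe]
  -- the eigenvalues `θ z ^ i * c` are distinct only for `c ≠ 0`
  by_cases hc : c = 0
  · have : Module.End.eigenspace (L a) c = ⊥ := by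
      rw [eq_bot_iff]
      intro v hv
      rw [Module.End.mem_eigenspace_iff, hc, zero_smul] at hv
      exact (Submodule.mem_bot K).2 (apply_injective a (hv.trans (map_zero _).symm))
    rw [this, finrank_bot, mul_zero]
    exact Nat.zero_le _
  let E : ℕ → Submodule K V := fun i => Module.End.eigenspace (L a) ((θ z : K) ^ i * c)
  have hstep : ∀ i, Module.finrank K (E i) ≤ Module.finrank K (E (i + 1)) := by
    intro i
    have hm : ∀ v ∈ E i, L y v ∈ E (i + 1) := by
      intro v hv
      have := h.apply_mem_eigenspace hz hv
      rwa [← mul_assoc, ← pow_succ'] at this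
    exact LinearMap.finrank_le_finrank_of_injective (f := (L y).restrict hm)
      fun v w hvw => Subtype.ext (apply_injective y (congrArg Subtype.val hvw))
  have hmono : ∀ i, Module.finrank K (E 0) ≤ Module.finrank K (E i) := by
    intro i
    induction i with
    | zero => exact le_rfl
    | succ i ih => exact ih.trans (hstep i)
  have hind : iSupIndep (fun i : Fin (orderOf (θ z)) => E i) := by
    refine (Module.End.eigenspaces_iSupIndep (L a)).comp (f := fun i : Fin (orderOf (θ z)) =>
      (θ z : K) ^ (i : ℕ) * c) fun i j hij => ?_
    have h1 : (θ z : K) ^ (i : ℕ) = (θ z : K) ^ (j : ℕ) := mul_right_cancel₀ hc hij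
    have h2 : θ z ^ (i : ℕ) = θ z ^ (j : ℕ) := Units.ext (by simpa using h1)
    exact Fin.ext (pow_injOn_Iio_orderOf i.2 j.2 h2)
  have hsum := sum_finrank_le_of_iSupIndep _ hind
  have hle := Finset.card_nsmul_le_sum Finset.univ
    (fun i : Fin (orderOf (θ z)) => Module.finrank K (E i)) _ fun i _ => hmono i
  rw [Finset.card_univ, Fintype.card_fin, smul_eq_mul] at hle
  have hE0 : E 0 = Module.End.eigenspace (L a) c := by
    simp only [E, pow_zero, one_mul]
  rw [ho, ← hE0]
  exact hle.trans hsum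

theorem IsSelfCentralizingLayer.le_orderOf [Finite G] {m r : ℕ}
    (hF : IsSelfCentralizingLayer T F m) (hT : IsMaximalCommutativeNormal T)
    (hr : ∀ p : ℕ, p.Prime → p ∣ T.relIndex F → r ≤ p) {x y : G}
    (hx : x ∈ centralizer (T : Set G)) (hy : y ∈ F) (hxy : ⁅x, y⁆ ∈ T) (hne : ⁅x, y⁆ ≠ 1) :
    r ≤ orderOf ⁅x, y⁆ := by
  have h1 : orderOf ⁅x, y⁆ ≠ 1 := fun h => hne (orderOf_eq_one_iff.1 h)
  exact (hr _ (Nat.minFac_prime h1) ((Nat.minFac_dvd _).trans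
    (hF.orderOf_commutatorElement_dvd hT hx hy hxy))).trans
      (Nat.minFac_le (orderOf_pos _))

/-- Let `r` be a lower bound for the primes dividing `|F : T|`. If `a` centralizes `F` modulo `T`,
its eigenspaces have dimension at most `dim V / r`. Otherwise some `y ∈ F` has `⁅a, y⁆ ∈ F \ T`, the
intersection of an eigenspace of `a` with its translate by `y` is fixed by `⁅a, y⁆`, and the former
case applies to this commutator. -/
theorem IsScalarAction.two_mul_finrank_eigenspace_le [Finite G] [FiniteDimensional K V]
    {m r : ℕ} (h : IsScalarAction T L θ) (hF : IsSelfCentralizingLayer T F m)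
    (hT : IsMaximalCommutativeNormal T) (hr1 : 1 ≤ r)
    (hr : ∀ p : ℕ, p.Prime → p ∣ T.relIndex F → r ≤ p)
    {a : centralizer (T : Set G)} (ha : (a : G) ∉ T) (c : K) :
    2 * r * Module.finrank K (Module.End.eigenspace (L a) c) ≤
      (r + 1) * Module.finrank K V := by
  have hFn := hF.normal
  have key : ∀ (b : centralizer (T : Set G)), (∀ y ∈ F, ⁅(b : G), y⁆ ∈ T) → (b : G) ∉ T →
      ∀ c : K, r * Module.finrank K (Module.End.eigenspace (L b) c) ≤ Module.finrank K V := by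
    intro b hb hbT c
    obtain ⟨y, hy, hne⟩ := hF.exists_commutatorElement_ne_one b.2 hbT
    have h1 := hF.le_orderOf hT hr b.2 hy (hb y hy) hne
    exact (Nat.mul_le_mul_right _ h1).trans
      (h.orderOf_mul_finrank_eigenspace_le (y := ⟨y, hF.le_centralizer hy⟩) (hb y hy) c)
  by_cases hb : ∀ y ∈ F, ⁅(a : G), y⁆ ∈ T
  · have h1 := key a hb ha c
    nlinarith [Nat.zero_le (Module.finrank K V)]
  · push Not at hb
    obtain ⟨y, hy, hyT⟩ := hb
    let y' : centralizer (T : Set G) := ⟨y, hF.le_centralizer hy⟩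
    have hwF : ⁅(a : G), y⁆ ∈ F := F.mul_mem (hFn.conj_mem y hy a) (F.inv_mem hy)
    have h1 := key ⁅a, y'⁆ (fun x hx => hF.commutator_mem _ hwF x hx) hyT 1
    set E := Module.End.eigenspace (L a) c
    have hinf : E ⊓ E.map (L y') ≤ Module.End.eigenspace (L ⁅a, y'⁆) 1 := by
      rintro _ ⟨hv, w, hw, rfl⟩
      have hv' := Module.End.mem_eigenspace_iff.1 hv
      have hw' := Module.End.mem_eigenspace_iff.1 hw
      rw [Module.End.mem_eigenspace_iff, one_smul]
      have e1 : ⁅a, y'⁆ * y' * a = a * y' := by rw [commutatorElement_def]; group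
      have e2 : L ⁅a, y'⁆ (L y' (L a w)) = L a (L y' w) := by
        rw [← Module.End.mul_apply, ← Module.End.mul_apply, ← map_mul, ← map_mul, e1, map_mul]
        rfl
      rw [hw', hv', map_smul, map_smul] at e2
      by_cases hc : c = 0
      · rw [hc, zero_smul] at hw'
        rw [apply_injective a (hw'.trans (map_zero _).symm), map_zero, map_zero]
      · exact smul_right_injective V hc e2
    have h2 := Submodule.finrank_sup_add_finrank_inf_eq E (E.map (L y'))
    have h3 : Module.finrank K (E.map (L y')) = Module.finrank K E :=
      (Submodule.equivMapOfInjective (L y') (apply_injective y') E).finrank_eq.symm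
    have h4 := Submodule.finrank_mono hinf
    have h5 := Submodule.finrank_le (E ⊔ E.map (L y'))
    rw [h3] at h2
    have h6 := Nat.mul_le_mul_left r (h4.trans (le_refl _))
    nlinarith

/-- Representatives of the cosets of `T` in `F` act as linearly independent operators, because
conjugation by `F` scales them by distinct characters. -/
theorem IsScalarAction.relIndex_le_finrank_sq [Finite G] [FiniteDimensional K V] [Nontrivial V]
    {m : ℕ} (h : IsScalarAction T L θ) (hF : IsSelfCentralizingLayer T F m) :
    T.relIndex F ≤ Module.finrank K V * Module.finrank K V := by
  have hFT : ∀ x ∈ F, ∀ t ∈ T, x * t = t * x := fun x hx t ht =>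
    (mem_centralizer_iff.1 (hF.le_centralizer hx) t ht).symm
  let γ : F →* F →* Kˣ := commPairing T F F θ hFT hFT hF.commutator_mem
  have hγ : ∀ x y : F, γ x y = 1 ↔ (x : G) * y = y * x := by
    intro x y
    rw [show γ x y = θ ⟨⁅(x : G), (y : G)⁆, hF.commutator_mem x x.2 y y.2⟩ from rfl,
      ← map_one θ, h.injective.eq_iff, Subtype.ext_iff]
    exact commutatorElement_eq_one_iff_mul_comm
  let A := centralizer (T : Set G)
  let j : F → A := fun x => ⟨x, hF.le_centralizer x.2⟩
  let s : F ⧸ T.subgroupOf F → F := Quotient.out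
  have hs : ∀ u, (s u : F ⧸ T.subgroupOf F) = u := fun u => Quotient.out_eq u
  have hconj : ∀ x y : F, L (j y) * L (j x) * L (j y)⁻¹ = (γ y x : K) • L (j x) := by
    intro x y
    have e1 : j y * j x * (j y)⁻¹ = ⁅j y, j x⁆ * j x := by rw [commutatorElement_def]; group
    rw [← map_mul, ← map_mul, e1, map_mul]
    ext v
    rw [Module.End.mul_apply, LinearMap.smul_apply]
    exact h.apply_eq_smul (a := ⁅j y, j x⁆) (hF.commutator_mem y y.2 x x.2) _
  have hchar : Function.Injective (fun u => (Units.coeHom K).comp (γ.flip (s u))) := by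
    intro u u' huu
    rw [← hs u, ← hs u', QuotientGroup.eq, mem_subgroupOf]
    refine hF.mem_of_commute _ (hF.le_centralizer (SetLike.coe_mem ((s u)⁻¹ * s u')))
      fun x hx => ?_
    refine (hγ ⟨x, hx⟩ ((s u)⁻¹ * s u')).1 ?_
    have h1 : γ ⟨x, hx⟩ (s u) = γ ⟨x, hx⟩ (s u') :=
      Units.ext (DFunLike.congr_fun huu (⟨x, hx⟩ : F))
    rw [map_mul, map_inv, h1, inv_mul_cancel]
  have hli := (linearIndependent_monoidHom F K).comp _ hchar
  have := Fintype.ofFinite (F ⧸ T.subgroupOf F)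
  have hind : LinearIndependent K (fun u => L (j (s u))) := by
    rw [Fintype.linearIndependent_iff] at hli ⊢
    intro g hg u
    by_contra hgu
    have hne : L (j (s u)) ≠ 0 := by
      intro h0
      obtain ⟨v, hv⟩ := exists_ne (0 : V)
      refine hv (apply_injective (L := L) (j (s u)) ?_)
      rw [h0]; rfl
    obtain ⟨ξ, hξ⟩ : ∃ ξ : Module.Dual K (Module.End K V), ξ (L (j (s u))) ≠ 0 := by
      by_contra! hh
      exact hne ((Module.forall_dual_apply_eq_zero_iff K _).1 hh)
    have h1 := hli (fun u => g u * ξ (L (j (s u)))) (by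
      ext y
      have h2 : L (j y) * (∑ u, g u • L (j (s u))) * L (j y)⁻¹ = 0 := by
        rw [hg, mul_zero, zero_mul]
      rw [Finset.mul_sum, Finset.sum_mul] at h2
      have h3 := congrArg ξ h2
      rw [map_sum, map_zero] at h3
      rw [Finset.sum_apply, Pi.zero_apply, ← h3]
      refine Finset.sum_congr rfl fun u _ => ?_
      rw [mul_smul_comm, smul_mul_assoc, hconj, map_smul, map_smul]
      simp only [Pi.smul_apply, smul_eq_mul, Function.comp]
      change g u * _ * (γ y (s u) : K) = _
      ring) u
    exact (mul_ne_zero hgu hξ) h1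
  have hle := hind.fintype_card_le_finrank
  rw [Module.finrank_linearMap, ← Nat.card_eq_fintype_card, ← index_eq_card] at hle
  exact hle

end ScalarAction

/-! ### Counting vectors with nontrivial stabilizer -/

section ScalarAction

variable {G K V : Type*} [Group G] {T F : Subgroup G} [Field K]
  [AddCommGroup V] [Module K V] {L : centralizer (T : Set G) →* Module.End K V}
  {θ : T →* Kˣ}

/-- The vectors that are fixed by some element of a coset of `T` in `C_G(T)`. -/
def cosetFixedPoints (L : centralizer (T : Set G) →* Module.End K V)
    (κ : centralizer (T : Set G) ⧸ T.subgroupOf (centralizer (T : Set G))) : Set V :=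
  {v | ∃ a : centralizer (T : Set G), (a : _ ⧸ T.subgroupOf (centralizer (T : Set G))) = κ ∧
    L a v = v}

/-- The vectors fixed by some element of the coset `x T` are eigenvectors of `x` with eigenvalues
in `θ(T)`, and at most one of these eigenspaces has more than half the dimension of `V`. -/
theorem IsScalarAction.ncard_cosetFixedPoints_le [Finite G] [Finite K] [Finite V]
    (h : IsScalarAction T L θ)
    (x : centralizer (T : Set G)) {A : ℕ}
    (hA : ∀ c : K, Module.finrank K (Module.End.eigenspace (L x) c) ≤ A) :
    (cosetFixedPoints L x).ncard ≤ Nat.card K ^ A +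
      Nat.card T * Nat.card K ^ (Module.finrank K V / 2) := by
  classical
  have := Fintype.ofFinite T
  -- a vector fixed by `x * t⁻¹` is an eigenvector of `x` with eigenvalue `θ t`
  set E : T → Submodule K V := fun t => Module.End.eigenspace (L x) (θ t : K) with hE
  set q := Nat.card K
  have hq : 0 < q := Nat.card_pos
  have hsub : cosetFixedPoints L x ⊆ ⋃ t ∈ (Finset.univ : Finset T), (E t : Set V) := by
    rintro v ⟨a, ha, hv⟩
    rw [eq_comm, QuotientGroup.eq, mem_subgroupOf] at ha
    have h1 := h.apply_eq_smul (L := L) ha v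
    refine Set.mem_biUnion (Finset.mem_coe.2 (Finset.mem_univ (⟨_, ha⟩⁻¹ : T))) ?_
    rw [SetLike.mem_coe, Module.End.mem_eigenspace_iff]
    rw [map_mul, Module.End.mul_apply, hv] at h1
    rw [map_inv, Units.val_inv_eq_inv_val, eq_inv_smul_iff₀ (Units.ne_zero _), ← map_smul]
    exact (congrArg (L x) h1).symm.trans (apply_self_inv_apply x v)
  have hcardE : ∀ t, (E t : Set V).ncard = q ^ Module.finrank K (E t) := by
    intro t
    exact Module.natCard_eq_pow_finrank (K := K) (V := E t)
  have hle : (cosetFixedPoints L x).ncard ≤ ∑ t, q ^ Module.finrank K (E t) := by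
    refine (Set.ncard_le_ncard hsub (Set.toFinite _)).trans ?_
    refine (Finset.set_ncard_biUnion_le _ _).trans (le_of_eq ?_)
    exact Finset.sum_congr rfl fun t _ => hcardE t
  refine hle.trans ?_
  by_cases hbig : ∃ t₀, Module.finrank K V / 2 < Module.finrank K (E t₀)
  · obtain ⟨t₀, ht₀⟩ := hbig
    rw [← Finset.add_sum_erase _ _ (Finset.mem_univ t₀)]
    refine Nat.add_le_add (Nat.pow_le_pow_right hq (hA _)) ?_
    have hsmall : ∀ t ∈ Finset.univ.erase t₀,
        q ^ Module.finrank K (E t) ≤ q ^ (Module.finrank K V / 2) := by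
      intro t ht
      refine Nat.pow_le_pow_right hq ?_
      have hne : (θ t : K) ≠ θ t₀ := fun hh =>
        Finset.ne_of_mem_erase ht (h.injective (Units.ext hh))
      have hdisj : Disjoint (E t) (E t₀) :=
        (Module.End.eigenspaces_iSupIndep (L x)).pairwiseDisjoint hne
      have h1 := Submodule.finrank_sup_add_finrank_inf_eq (E t) (E t₀)
      rw [hdisj.eq_bot, finrank_bot] at h1
      have h2 := Submodule.finrank_le (E t ⊔ E t₀)
      omega
    refine (Finset.sum_le_card_nsmul _ _ _ hsmall).trans ?_
    rw [smul_eq_mul]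
    refine Nat.mul_le_mul_right _ ?_
    rw [Nat.card_eq_fintype_card]
    exact Finset.card_le_univ _
  · push Not at hbig
    refine (Finset.sum_le_card_nsmul _ _ _ fun t _ =>
      Nat.pow_le_pow_right hq (hbig t)).trans ?_
    rw [smul_eq_mul, Finset.card_univ, ← Nat.card_eq_fintype_card]
    exact Nat.le_add_left _ _

theorem IsScalarAction.eq_one_of_apply_eq (h : IsScalarAction T L θ)
    {a : centralizer (T : Set G)} (ha : (a : G) ∈ T) {v : V} (hv : v ≠ 0) (hav : L a v = v) :
    a = 1 := by
  rw [h.apply_eq_smul ha] at hav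
  have h1 : (θ ⟨a, ha⟩ : K) = 1 := by
    have : ((θ ⟨a, ha⟩ : K) - 1) • v = 0 := by rw [sub_smul, hav, one_smul, sub_self]
    exact sub_eq_zero.1 ((smul_eq_zero.1 this).resolve_right hv)
  have h2 : (⟨a, ha⟩ : T) = 1 := h.injective (by rw [map_one]; exact Units.ext h1)
  exact Subtype.ext (congrArg Subtype.val h2 :)

/-- If every vector were fixed by a nontrivial element of `C_G(T)`, every vector would lie in the
sets `cosetFixedPoints` of a nontrivial coset and of its inverse, which are distinct because the
order is odd. -/
theorem IsScalarAction.two_mul_card_le [Finite G] [Finite V]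
    (h : IsScalarAction T L θ) [Nontrivial V]
    (hT : T.Normal) (hodd : Odd (Nat.card G))
    (hbad : ∀ v : V, ∃ a : centralizer (T : Set G), a ≠ 1 ∧ L a v = v) {s : ℕ}
    (hs : ∀ x : centralizer (T : Set G), (x : G) ∉ T → (cosetFixedPoints L x).ncard ≤ s) :
    2 * Nat.card V ≤ (T.relIndex (centralizer (T : Set G)) - 1) * s := by
  classical
  let N := T.subgroupOf (centralizer (T : Set G))
  let Q := centralizer (T : Set G) ⧸ N
  have := Fintype.ofFinite Q
  have := Fintype.ofFinite V
  have hQodd : Odd (Nat.card Q) := by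
    refine hodd.of_dvd_nat ?_
    have h1 : Nat.card Q = N.index := (index_eq_card N).symm
    rw [h1]
    exact (index_dvd_card N).trans (card_subgroup_dvd_card _)
  have hpair : ∀ v : V, v ≠ 0 → ∃ κ : Q, κ ≠ 1 ∧ κ⁻¹ ≠ κ ∧ v ∈ cosetFixedPoints L κ ∧
      v ∈ cosetFixedPoints L κ⁻¹ := by
    intro v hv
    obtain ⟨a, ha1, hav⟩ := hbad v
    have haT : (a : G) ∉ T := fun hh => ha1 (h.eq_one_of_apply_eq hh hv hav)
    have hκ : (a : Q) ≠ 1 := fun hh => haT (mem_subgroupOf.1 ((QuotientGroup.eq_one_iff a).1 hh))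
    refine ⟨a, hκ, fun hinv => hκ ?_, ⟨a, rfl, hav⟩, ⟨a⁻¹, rfl, ?_⟩⟩
    · have h2 : (a : Q) ^ 2 = 1 := by
        rw [pow_two]
        conv_lhs => enter [1]; rw [← hinv]
        exact inv_mul_cancel _
      have h3 : orderOf (a : Q) ∣ 2 := orderOf_dvd_of_pow_eq_one h2
      have h4 : Odd (orderOf (a : Q)) := hQodd.of_dvd_nat (_root_.orderOf_dvd_natCard _)
      rcases (Nat.dvd_prime Nat.prime_two).1 h3 with h5 | h5
      · exact orderOf_eq_one_iff.1 h5
      · rw [h5] at h4; exact absurd h4 (by decide)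
    · conv_lhs => rw [← hav]
      exact apply_inv_apply_self a v
  have hzero : ∀ κ : Q, (0 : V) ∈ cosetFixedPoints L κ := by
    intro κ
    obtain ⟨a, rfl⟩ := QuotientGroup.mk_surjective κ
    exact ⟨a, rfl, map_zero _⟩
  have hpair' : ∀ v : V, ∃ κ : Q, κ ≠ 1 ∧ κ⁻¹ ≠ κ ∧ v ∈ cosetFixedPoints L κ ∧
      v ∈ cosetFixedPoints L κ⁻¹ := by
    intro v
    by_cases hv : v = 0
    · obtain ⟨w, hw⟩ := exists_ne (0 : V)
      obtain ⟨κ, h1, h2, -, -⟩ := hpair w hw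
      exact ⟨κ, h1, h2, hv ▸ hzero _, hv ▸ hzero _⟩
    · exact hpair v hv
  have hge : ∀ v ∈ (Finset.univ : Finset V),
      2 ≤ ((Finset.univ.erase (1 : Q)).filter (fun κ => v ∈ cosetFixedPoints L κ)).card := by
    intro v _
    obtain ⟨κ, h1, h2, h3, h4⟩ := hpair' v
    rw [← Finset.card_pair h2.symm]
    refine Finset.card_le_card fun x hx => ?_
    rw [Finset.mem_insert, Finset.mem_singleton] at hx
    rcases hx with rfl | rfl
    · simp [h1, h3]
    · simp [h1, h4]
  have hdouble : ∑ v : V, ((Finset.univ.erase (1 : Q)).filter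
      (fun κ => v ∈ cosetFixedPoints L κ)).card =
      ∑ κ ∈ Finset.univ.erase (1 : Q), (cosetFixedPoints L κ).ncard := by
    have h1 := Finset.sum_card_bipartiteAbove_eq_sum_card_bipartiteBelow
      (s := (Finset.univ : Finset V)) (t := Finset.univ.erase (1 : Q))
      (fun v κ => v ∈ cosetFixedPoints L κ)
    refine h1.trans (Finset.sum_congr rfl fun κ _ => ?_)
    rw [Set.ncard_eq_toFinset_card', Finset.bipartiteBelow]
    congr 1
    ext v
    simp
  have h1 := Finset.card_nsmul_le_sum _ _ _ hge
  rw [hdouble, smul_eq_mul, Finset.card_univ, ← Nat.card_eq_fintype_card] at h1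
  have h2 : ∀ κ ∈ Finset.univ.erase (1 : Q), (cosetFixedPoints L κ).ncard ≤ s := by
    intro κ hκ
    obtain ⟨x, rfl⟩ := QuotientGroup.mk_surjective κ
    refine hs x fun hx => Finset.ne_of_mem_erase hκ ?_
    exact (QuotientGroup.eq_one_iff x).2 (mem_subgroupOf.2 hx)
  have h3 := Finset.sum_le_card_nsmul _ _ _ h2
  rw [Finset.card_erase_of_mem (Finset.mem_univ _), Finset.card_univ, smul_eq_mul,
    ← Nat.card_eq_fintype_card, ← index_eq_card] at h3
  rw [mul_comm]
  exact h1.trans h3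

/-- Counting the vectors with a nontrivial stabilizer in `C_G(T)`, coset by coset of `T`, shows that
there are too few of them to fill `V`. -/
theorem IsScalarAction.exists_regular_vector [Finite G] [Finite K] [Finite V]
    (h : IsScalarAction T L θ) [Nontrivial V]
    (hT : IsMaximalCommutativeNormal T) (hG : Group.IsSolvable G) (hodd : Odd (Nat.card G))
    (hV : Odd (Nat.card V)) :
    ∃ v : V, ∀ a : centralizer (T : Set G), L a v = v → a = 1 := by
  by_contra! hbad
  have hbad' : ∀ v : V, ∃ a : centralizer (T : Set G), a ≠ 1 ∧ L a v = v := fun v => by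
    obtain ⟨a, h1, h2⟩ := hbad v
    exact ⟨a, h2, h1⟩
  obtain ⟨F, m, hF⟩ := hT.exists_layer hG
  obtain ⟨e, he, he3, hM, h5, h7, h9, h27⟩ := hF.exists_relIndex_le hT hG hodd θ h.injective
  set M := T.relIndex (centralizer (T : Set G))
  set q := Nat.card K
  set d := Module.finrank K V
  set τ := Nat.card T
  have hd : 0 < d := Module.finrank_pos
  have hVq : Nat.card V = q ^ d := Module.natCard_eq_pow_finrank
  have hqodd : Odd q := (Nat.odd_pow_iff hd.ne').1 (hVq ▸ hV)
  have hτodd : Odd τ := hodd.of_dvd_nat (card_subgroup_dvd_card T)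
  have hq1 : 1 < q := Finite.one_lt_card
  -- `τ` divides `q - 1`, which is even, while `τ` is odd
  have hτq : 2 * τ + 1 ≤ q := by
    have h1 : τ ∣ q - 1 := by
      have := Fintype.ofFinite K
      have h2 : Nat.card Kˣ = q - 1 := Nat.card_units K
      rw [← h2]
      exact card_dvd_of_injective θ h.injective
    obtain ⟨c, hc⟩ := h1
    obtain ⟨i, hi⟩ := hqodd
    obtain ⟨j, hj⟩ := hτodd
    have hc0 : c ≠ 0 := by rintro rfl; omega
    have hc1 : c ≠ 1 := by rintro rfl; omega
    have : τ * 2 ≤ τ * c := Nat.mul_le_mul_left _ (by omega)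
    omega
  have heodd : Odd e := by
    have h1 : Odd (T.relIndex F) := hodd.of_dvd_nat
      ((relIndex_dvd_card T F).trans (card_subgroup_dvd_card F))
    rw [he] at h1
    exact (Nat.odd_mul.1 h1).1
  have hed : e ≤ d := by
    have h1 := h.relIndex_le_finrank_sq hF
    rw [he] at h1
    exact Nat.mul_self_le_mul_self_iff.1 h1
  have hpe : ∀ p : ℕ, p.Prime → p ∣ T.relIndex F → p ∣ e := by
    intro p hp hpd
    rw [he] at hpd
    exact (hp.dvd_mul.1 hpd).elim id id
  set a := if 3 ∣ e then 2 * d / 3 else 3 * d / 5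
  have ha : ∀ x : centralizer (T : Set G), (x : G) ∉ T → ∀ c : K,
      Module.finrank K (Module.End.eigenspace (L x) c) ≤ a := by
    have hodd_prime : ∀ p : ℕ, p.Prime → p ∣ e → 3 ≤ p ∧ p ≠ 4 := by
      intro p hp hpd
      have hpo : Odd p := heodd.of_dvd_nat hpd
      refine ⟨?_, by rintro rfl; exact absurd hpo (by decide)⟩
      rcases hp.two_le.eq_or_lt with h1 | h1
      · rw [← h1] at hpo; exact absurd hpo (by decide)
      · exact h1
    intro x hx c
    by_cases h3 : 3 ∣ e
    -- the primes dividing `e` are at least `3`, and at least `5` if `3` does not divide `e`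
    · have h1 := h.two_mul_finrank_eigenspace_le hF hT (r := 3) (by norm_num)
        (fun p hp hpd => (hodd_prime p hp (hpe p hp hpd)).1) hx c
      simp only [a, if_pos h3]
      omega
    · have h1 := h.two_mul_finrank_eigenspace_le hF hT (r := 5) (by norm_num)
        (fun p hp hpd => by
          have h2 := hodd_prime p hp (hpe p hp hpd)
          have h4 : p ≠ 3 := by rintro rfl; exact h3 (hpe 3 hp hpd)
          omega) hx c
      simp only [a, if_neg h3]
      omega
  have hcount := h.two_mul_card_le hT.normal hodd hbad'
    fun x hx => h.ncard_cosetFixedPoints_le x (ha x hx)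
  rw [hVq] at hcount
  have hMlt := three_mul_sub_one_lt heodd he3 (Nat.card_pos (α := T)).ne'
    (fun p hp hpd => hF.prime_dvd_card hT hp (he ▸ hpd.mul_left e)) hτq hM h5 h7 h9 h27
  have he1 : e ≠ 1 := by
    rintro rfl
    have hM1 : M ≤ 1 := by simpa using hM
    have h0 : M - 1 = 0 := by omega
    change 2 * q ^ d ≤ (M - 1) * _ at hcount
    rw [h0, zero_mul] at hcount
    have : 0 < q ^ d := Nat.pow_pos (by omega)
    omega
  have he5 : 5 ≤ e := by
    obtain ⟨i, hi⟩ := heodd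
    omega
  have hfin := sub_one_mul_lt_two_mul_pow (a := a) (b := d / 2) heodd he5 hτq hMlt hed
    (by simp only [a]; split_ifs <;> omega) (by omega)
  exact absurd hcount (not_le.2 hfin)

end ScalarAction

/-! ### Fields of endomorphisms and the reduction to the regular vector -/

/-- The automorphism group of a finite field is cyclic, being its Galois group over the prime
field. -/
theorem isCyclic_ringAut (K : Type*) [Field K] [Finite K] : IsCyclic (K ≃+* K) := by
  obtain ⟨p, hp⟩ := CharP.exists K
  have : Fact p.Prime := ⟨CharP.char_is_prime K p⟩
  let : Algebra (ZMod p) K := ZMod.algebra K p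
  let f : (K ≃+* K) →* Gal(K/ZMod p) :=
    { toFun := fun e => AlgEquiv.ofRingEquiv (f := e) fun x => by
        obtain ⟨n, rfl⟩ := ZMod.natCast_zmod_surjective x
        simp
      map_one' := by ext; rfl
      map_mul' := fun _ _ => by ext; rfl }
  refine isCyclic_of_injective f fun a b hab => ?_
  ext x
  exact DFunLike.congr_fun hab x

section Conjugation

variable {R G V K : Type*} [CommRing R] [Group G] [AddCommGroup V] [Module R V] [Field K]

/-- A field of endomorphisms normalized by `ρ` is permuted by conjugation with `ρ g`. -/
theorem exists_conjugation_hom [Nontrivial V] (ρ : Representation R G V)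
    (ι : K →+* Module.End R V) (hconj : ∀ g c, ∃ d, ρ g * ι c * ρ g⁻¹ = ι d) :
    ∃ σ : G →* (K ≃+* K), ∀ g c, ρ g * ι c = ι (σ g c) * ρ g := by
  have hι : Function.Injective ι := ι.injective
  have hinv : ∀ g, ρ g⁻¹ * ρ g = 1 := fun g => by rw [← map_mul, inv_mul_cancel, map_one]
  choose s hs using hconj
  have hs' : ∀ g c, ρ g * ι c = ι (s g c) * ρ g := fun g c => by
    rw [← hs, mul_assoc, hinv, mul_one]
  have huniq : ∀ g c d, ρ g * ι c = ι d * ρ g → s g c = d := fun g c d h => hι <| by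
    rw [← hs, h, mul_assoc, ← map_mul, mul_inv_cancel, map_one, mul_one]
  have hsmul : ∀ g h c, s (g * h) c = s g (s h c) := fun g h c => huniq _ _ _ <| by
    rw [map_mul, mul_assoc, hs', ← mul_assoc, hs', mul_assoc]
  have hsone : ∀ c, s 1 c = c := fun c => huniq _ _ _ <| by rw [map_one, one_mul, mul_one]
  let σ : G → (K ≃+* K) := fun g =>
    { toFun := s g
      invFun := s g⁻¹
      left_inv := fun c => by rw [← hsmul, inv_mul_cancel, hsone]
      right_inv := fun c => by rw [← hsmul, mul_inv_cancel, hsone]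
      map_mul' := fun c d => huniq _ _ _ <| by
        rw [map_mul, map_mul, ← mul_assoc, hs', mul_assoc, hs', mul_assoc]
      map_add' := fun c d => huniq _ _ _ <| by
        rw [map_add, map_add, mul_add, hs', hs', add_mul] }
  exact ⟨⟨⟨σ, RingEquiv.ext hsone⟩, fun g h => RingEquiv.ext (hsmul g h)⟩, hs'⟩

/-- Suppose that the endomorphisms `ρ t`, `t ∈ T`, lie in a finite field that `ρ` normalizes and
that commutes with `C_G(T)`. If `v` is a vector with trivial stabilizer in `C_G(T)`, the centralizer
of `v` in `G` embeds in the automorphism group of the field. -/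
theorem exists_isCyclic_vectorCentralizer_of_field [Finite G] [Finite V] [Nontrivial V] [Finite K]
    (ρ : Representation R G V) (hinj : Function.Injective ρ) (hG : Group.IsSolvable G)
    (hodd : Odd (Nat.card G)) (hV : Odd (Nat.card V))
    {T : Subgroup G} (hT : IsMaximalCommutativeNormal T) (ι : K →+* Module.End R V)
    (hconj : ∀ g c, ∃ d, ρ g * ι c * ρ g⁻¹ = ι d) (hscal : ∀ t ∈ T, ∃ c, ρ t = ι c)
    (hcomm : ∀ a ∈ centralizer (T : Set G), ∀ c, ρ a * ι c = ι c * ρ a) :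
    ∃ v : V, IsCyclic (ρ.vectorCentralizer v) := by
  have hι : Function.Injective ι := ι.injective
  obtain ⟨σ, hσ⟩ := exists_conjugation_hom ρ ι hconj
  let : Module K V := Module.compHom V ι
  have hsmul : ∀ (c : K) (v : V), c • v = ι c v := fun _ _ => rfl
  choose s hs using fun t : T => hscal t t.2
  let θ₀ : T →* K :=
    { toFun := s
      map_one' := hι (by rw [← hs, map_one, coe_one, map_one])
      map_mul' := fun a b => hι (by rw [← hs, map_mul, coe_mul, map_mul, hs, hs]) }
  let L : centralizer (T : Set G) →* Module.End K V :=
    { toFun := fun a =>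
        { toFun := ρ a
          map_add' := map_add _
          map_smul' := fun c v => LinearMap.congr_fun (hcomm a a.2 c) v }
      map_one' := LinearMap.ext fun v => by
        change ρ ((1 : centralizer (T : Set G)) : G) v = v
        rw [coe_one, map_one]; rfl
      map_mul' := fun a b => LinearMap.ext fun v => by
        change ρ ((a * b : centralizer (T : Set G)) : G) v = ρ a (ρ b v)
        rw [coe_mul, map_mul]; rfl }
  have h : IsScalarAction T L θ₀.toHomUnits :=
    { comm := fun t ht => mem_centralizer_iff.2 fun x hx => hT.comm x hx t ht
      scalar := fun t v => LinearMap.congr_fun (hs t) v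
      injective := fun a b hab => Subtype.ext <| hinj <| by
        have : s a = s b := congrArg Units.val hab
        rw [hs, hs, this] }
  obtain ⟨v, hv⟩ := h.exists_regular_vector hT hG hodd hV
  have := isCyclic_ringAut K
  refine ⟨v, isCyclic_of_injective (σ.comp (ρ.vectorCentralizer v).subtype) ?_⟩
  rw [injective_iff_map_eq_one]
  rintro ⟨g, hg⟩ hg1
  -- an element inducing the trivial automorphism commutes with the scalars `ρ t`
  have hgC : g ∈ centralizer (T : Set G) := mem_centralizer_iff.2 fun t ht => hinj <| by
    have h1 := hσ g (s ⟨t, ht⟩)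
    have h2 : σ g = 1 := hg1
    rw [h2, RingAut.one_apply, ← hs] at h1
    rw [map_mul, map_mul, h1]
  have h3 := hv ⟨g, hgC⟩ hg
  exact Subtype.ext (Subtype.ext_iff.1 h3 :)

end Conjugation

section Homogeneous

/-- Multiplication by an element of a commutative ring on an isotypic semisimple module is either
zero or injective: a kernel contains a simple submodule, and the element then kills every simple
submodule. -/
theorem IsIsotypic.smul_eq_zero {A M : Type*} [CommRing A] [AddCommGroup M] [Module A M]
    [IsSemisimpleModule A M] (hM : IsIsotypic A M) {f : A} {x : M} (hx : x ≠ 0)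
    (hfx : f • x = 0) (m : M) : f • m = 0 := by
  obtain ⟨S, hS, hSx⟩ : ∃ S : Submodule A M, IsSimpleModule A S ∧
      S ≤ LinearMap.ker (LinearMap.lsmul A M f) := by
    have hne : LinearMap.ker (LinearMap.lsmul A M f) ≠ ⊥ := fun h0 =>
      hx ((Submodule.mem_bot A).1 (h0 ▸ (LinearMap.mem_ker.2 hfx)))
    obtain ⟨S, hS, hle⟩ := (eq_bot_or_exists_atom_le _).resolve_left hne
    exact ⟨S, isSimpleModule_iff_isAtom.2 hS, hle⟩
  have htop : (⊤ : Submodule A M) ≤ LinearMap.ker (LinearMap.lsmul A M f) := by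
    rw [← IsSemisimpleModule.sSup_simples_eq_top A M]
    refine sSup_le fun S' (hS' : IsSimpleModule A S') y hy => ?_
    obtain ⟨e⟩ := hM S S'
    have h1 : f • (e ⟨y, hy⟩ : M) = 0 := LinearMap.mem_ker.1 (hSx (e ⟨y, hy⟩).2)
    have h2 : f • e ⟨y, hy⟩ = 0 := Subtype.ext h1
    rw [← map_smul, map_eq_zero_iff e e.injective] at h2
    exact LinearMap.mem_ker.2 (congrArg Subtype.val h2)
  exact LinearMap.mem_ker.1 (htop (Submodule.mem_top (x := m)))

variable {R H V : Type*} [CommRing R] [AddCommGroup V] [Module R V]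

/-- Schur's lemma for the algebra generated by a homogeneous action of a commutative group: its
nonzero elements are injective. -/
theorem Representation.IsHomogeneous.eq_zero_of_mem_adjoin [Group H] {ρ : Representation R H V}
    (hρ : ρ.IsHomogeneous) (hH : ∀ x y : H, x * y = y * x) {f : Module.End R V}
    (hf : f ∈ Algebra.adjoin R (Set.range ρ)) {x : V} (hx : x ≠ 0) (hfx : f x = 0) : f = 0 := by
  let : CommGroup H := { ‹Group H› with mul_comm := hH }
  obtain ⟨a, rfl⟩ : f ∈ ρ.asAlgebraHom.range := by
    refine Algebra.adjoin_le ?_ hf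
    rintro _ ⟨h, rfl⟩
    exact ⟨_, ρ.asAlgebraHom_single_one h⟩
  have := hρ.1
  ext v
  exact IsIsotypic.smul_eq_zero (A := MonoidAlgebra R H) (M := ρ.asModule) hρ.2 (f := a)
    (x := (x : V)) hx hfx v

/-- A finite commutative ring of endomorphisms whose nonzero elements are injective is a field. -/
theorem Subalgebra.isField_of_injective [Finite V] [Nontrivial V]
    (S : Subalgebra R (Module.End R V)) (hcomm : ∀ x ∈ S, ∀ y ∈ S, x * y = y * x)
    (h0 : ∀ f ∈ S, ∀ x : V, x ≠ 0 → f x = 0 → f = 0) : IsField S where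
  exists_pair_ne := ⟨0, 1, fun h => zero_ne_one (congrArg Subtype.val h)⟩
  mul_comm := fun x y => Subtype.ext (hcomm x x.2 y y.2)
  mul_inv_cancel := by
    intro a ha
    have : Finite (Module.End R V) := Finite.of_injective _ DFunLike.coe_injective
    have hinj : Function.Injective fun b : S => a * b := by
      intro b c hbc
      have h1 : (a : Module.End R V) * ((b : Module.End R V) - c) = 0 := by
        rw [mul_sub, sub_eq_zero]; exact congrArg Subtype.val hbc
      refine Subtype.ext (LinearMap.ext fun v => ?_)
      by_contra hv
      refine ha (Subtype.ext (h0 a a.2 ((b : Module.End R V) v - (c : Module.End R V) v)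
        (sub_ne_zero.2 hv) (LinearMap.congr_fun h1 v)))
    exact (Finite.injective_iff_surjective.1 hinj) 1

end Homogeneous

theorem mainTheorem4 {R G V : Type*} [CommRing R] [Group G] [Finite G]
    [AddCommGroup V] [Module R V] [Finite V] (ρ : Representation R G V)
    (hsolv : Group.IsSolvable G)
    (hfaithful : Function.Injective ρ)
    (hqp : ρ.IsQuasiprimitive)
    (hodd : Odd (Nat.card V * Nat.card G)) :
    ∃ v : V, IsCyclic (ρ.vectorCentralizer v) := by
  obtain ⟨hV, hG⟩ := Nat.odd_mul.1 hodd
  cases subsingleton_or_nontrivial V with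
  | inl hsub =>
    -- a group acting faithfully on the zero module is trivial
    have : Subsingleton G := ⟨fun a b => hfaithful (Subsingleton.elim _ _)⟩
    exact ⟨0, inferInstance⟩
  | inr hnt =>
    obtain ⟨T, hT⟩ := exists_isMaximalCommutativeNormal G
    -- the image of `R[T]` in `End V`, which will serve as the field of scalars
    set S : Subalgebra R (Module.End R V) := Algebra.adjoin R (Set.range (ρ.restrictSubgroup T))
      with hS
    have hgen : ∀ t ∈ T, ρ t ∈ S := fun t ht => Algebra.subset_adjoin ⟨⟨t, ht⟩, rfl⟩
    have hC : ∀ a ∈ centralizer (T : Set G), ∀ c ∈ S, Commute (ρ a) c := by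
      intro a ha c hc
      refine Algebra.commute_of_mem_adjoin_of_forall_mem_commute hc ?_
      rintro _ ⟨t, rfl⟩
      change ρ a * ρ t = ρ t * ρ a
      rw [← map_mul, ← map_mul, mem_centralizer_iff.1 ha t t.2]
    have hcomm : ∀ x ∈ S, ∀ y ∈ S, x * y = y * x := by
      intro x hx y hy
      refine (Algebra.commute_of_mem_adjoin_of_forall_mem_commute hx ?_).eq.symm
      rintro _ ⟨t, rfl⟩
      exact (hC t (mem_centralizer_iff.2 fun x hx => hT.comm x hx t t.2) y hy).symm
    have hfield : IsField S := S.isField_of_injective hcomm fun f hf x hx hfx =>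
      (hqp.2 T hT.normal).eq_zero_of_mem_adjoin
        (fun a b => Subtype.ext (hT.comm a a.2 b b.2)) hf hx hfx
    have : Finite (Module.End R V) := Finite.of_injective _ DFunLike.coe_injective
    let : Field S := hfield.toField
    refine exists_isCyclic_vectorCentralizer_of_field ρ hfaithful hsolv hG hV hT
      (S.val : S →+* Module.End R V) ?_ (fun t ht => ⟨⟨ρ t, hgen t ht⟩, rfl⟩)
      (fun a ha c => hC a ha c c.2)
    rintro g ⟨c, hc⟩
    suffices ρ g * c * ρ g⁻¹ ∈ S from ⟨⟨_, this⟩, rfl⟩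
    have h1 : ρ g⁻¹ * ρ g = 1 := by rw [← map_mul, inv_mul_cancel, map_one]
    have h2 : ρ g * ρ g⁻¹ = 1 := by rw [← map_mul, mul_inv_cancel, map_one]
    induction hc using Algebra.adjoin_induction with
    | mem x hx =>
      obtain ⟨t, rfl⟩ := hx
      change ρ g * ρ t * ρ g⁻¹ ∈ S
      rw [← map_mul, ← map_mul]
      exact hgen _ (hT.normal.conj_mem t t.2 g)
    | algebraMap r =>
      rw [← Algebra.commutes, mul_assoc, h2, mul_one]
      exact S.algebraMap_mem r
    | add x y _ _ hx hy =>
      rw [mul_add, add_mul]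
      exact S.add_mem hx hy
    | mul x y _ _ hx hy =>
      have : ρ g * (x * y) * ρ g⁻¹ = (ρ g * x * ρ g⁻¹) * (ρ g * y * ρ g⁻¹) := by
        calc ρ g * (x * y) * ρ g⁻¹ = ρ g * x * 1 * y * ρ g⁻¹ := by noncomm_ring
          _ = _ := by rw [← h1]; noncomm_ring
      rw [this]
      exact S.mul_mem hx hy
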